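/- **Setting.** Let $\mathscr P$ be a contour (a path made of regular $C^1$ arcs) in $\mathbb C$ from a finite point $a$ to a finite or infinite point $b$; $(a,b)_{\mathscr P}$ denotes $\mathscr P$ without its endpoints. Let $\mu>\nu\ge 0$ be real and $\lambda\in\mathbb C$ with $\operatorname{Re}\lambda>0$. For $z=|z|e^{i\theta}$ put $$I(z)=\int_{\mathscr P}\exp\left(-zp(t)+z^{\nu/\mu}r(t)\right)q(t)\,dt ,$$ where all powers $z^{c}$ mean $\exp(c(\log|z|+i\theta))$. Assume: (i) $p,q,r$ do not depend on $z$ and are single-valued and analytic in a domain $\mathbf T$. (ii) $\mathscr P$ does not depend on $z$, and $(a,b)_{\mathscr P}\subset\mathbf T$. (iii) Let $\varpi=\lim\arg(t-a)$ as $t\to a$ along $\mathscr P$, for a branch of $\arg(t-a)$ that is continuous on $(a,b)_{\mathscr P}$; powers of $t-a$ are formed with this branch. Near $a$ there are convergent expansions $$p(t)=p(a)+\sum_{n\ge0}p_n(t-a)^{n+\mu},\quad q(t)=\sum_{n\ge0}q_n(t-a)^{n+\lambda-1},\quad r(t)=\sum_{n\ge0}r_n(t-a)^{n+\nu},\qquad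 p_0\neq0 .$$ (iv) $\theta_1\le\theta_2$, $\theta_2-\theta_1<\pi$, $Z>0$, and for $\theta\in[\theta_1,\theta_2]$ the integral $I(Ze^{i\theta})$ converges at $b$ both absolutely and uniformly with respect to $\theta$. (v) There is $\delta>0$ such that, for all $\theta\in[\theta_1,\theta_2]$ and $t\in(a,b)_{\mathscr P}$, $p(t)\ne p(a)$ and $|\arg(e^{i\theta}p(t)-e^{i\theta}p(a))|\le\frac\pi2-\delta$; moreover $\operatorname{Re}(e^{i\theta}p(t)-e^{i\theta}p(a))$ is bounded away from zero, uniformly in $\theta$, as $t\to b$ along $\mathscr P$. (vi) $r(t)=\mathcal O(|p(t)-p(a)|)$ as $t\to b$ along $\mathscr P$. **Notation.** $\operatorname{Fi}(\alpha,\beta;x)=\int_0^{\infty}\exp(-t+xt^{\alpha})t^{\beta-1}\,dt$ for $0\le\alpha<1$, $\operatorname{Re}\beta>0$ (Faxén's integral). For a value $\varpi_0$ of $\arg p_0$, powers of $p_0$ are $p_0^{c}=\exp(c(\log|p_0|+i\varpi_0))$, and powers of $p(t)-p(a)$ near $a$ are those that behave like $p_0^{c}(t-a)^{\mu c}$ as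 $t\to a$. Put $$b_n=\frac1\mu\operatorname*{Res}_{t=a}\frac{q(t)}{(p(t)-p(a))^{(n+\lambda)/\mu}}\ (n\ge0),\qquad c_n=\frac1\mu\operatorname*{Res}_{t=a}\frac{p'(t)r(t)}{(p(t)-p(a))^{(n+\nu)/\mu+1}}\ (n\ge1),$$ $$f_{n,m}=\frac1{m!}\sum_{j=m}^{n}b_{n-j}\,\mathsf B_{j,m}(c_1,\dots,c_{j-m+1})\qquad(0\le m\le n),$$ where the partial ordinary Bell polynomials are given by $\left(\sum_{k\ge1}c_kx^k\right)^m=\sum_{n}\mathsf B_{n,m}(c_1,\dots,c_{n-m+1})x^n$. (The quotients under the residue signs are single-valued near $a$, with at most a pole at $a$.) **Theorem.** There is exactly one value $\varpi_0$ of $\arg p_0$ with $|\varpi_0+\theta+\mu\varpi|\le\frac\pi2$ for all $\theta\in[\theta_1,\theta_2]$. With this $\varpi_0$, $$I(z)\sim e^{-zp(a)}\sum_{n=0}^{\infty}\frac1{z^{(n+\lambda)/\mu}}\sum_{m=0}^{n}f_{n,m}\operatorname{Fi}\left(\frac\nu\mu,\frac{n+\lambda+m\nu}\mu;\frac{r_0}{p_0^{\nu/\mu}}\right)$$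 as $|z|\to\infty$, uniformly in the sector $\theta_1\le\theta\le\theta_2$. That is, for every integer $N\ge0$ there are constants $C$ and $R>0$ such that, for $|z|\ge R$ and $\theta\in[\theta_1,\theta_2]$, the integral $I(z)$ converges absolutely and differs from $e^{-zp(a)}$ times the partial sum over $n<N$ by at most $C\,|e^{-zp(a)}|\,|z|^{-(N+\operatorname{Re}\lambda)/\mu}$. In particular $$f_{0,0}=\frac{q_0}{\mu p_0^{\lambda/\mu}},\quad f_{1,0}=\left(\frac{q_1}{\mu}-\frac{(\lambda+1)p_1q_0}{\mu^2p_0}\right)\frac1{p_0^{(1+\lambda)/\mu}},\quad f_{1,1}=\left(\frac{r_1}{\mu}-\frac{\nu p_1r_0}{\mu^2p_0}\right)\frac{q_0}{p_0^{(1+\lambda+\nu)/\mu}} .$$ -/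

import Mathlib

open Complex Set Filter Topology MeasureTheory

noncomputable section

namespace FaxenExpansion

/-- The power `x ^ c` of the number `x = ρ * exp (i θ)`, `ρ > 0`, for the branch determined by
the phase `θ` (which is not restricted to the principal range): `exp (c * (log ρ + i θ))`. -/
def polarPow (ρ θ : ℝ) (c : ℂ) : ℂ :=
  Complex.exp (c * ((Real.log ρ : ℝ) + (θ : ℝ) * I))

/-- Faxén's integral `Fi(α, β; x) = ∫_0^∞ exp (-t + x t ^ α) t ^ (β - 1) dt`
(for `0 ≤ α < 1` and `0 < Re β`). -/
def faxen (α : ℝ) (β x : ℂ) : ℂ :=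
  ∫ t in Ioi (0 : ℝ), Complex.exp (-(t : ℂ) + x * ((t ^ α : ℝ) : ℂ)) * (t : ℂ) ^ (β - 1)

/-- A contour from the finite point `a` to the finite or infinite point `b`, parametrized by
`[0, 1)`: it starts at `a`, tends to `b` at `1`, and is made of regular `C¹` arcs, whose
endpoints may accumulate only at the parameter `1`. -/
structure IsContour (γ : ℝ → ℂ) (a : ℂ) (b : OnePoint ℂ) : Prop where
  start : γ 0 = a
  finish : Tendsto (fun s : ℝ => ((γ s : ℂ) : OnePoint ℂ)) (𝓝[<] (1 : ℝ)) (𝓝 b)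
  arcs : ∃ σ : ℕ → ℝ, StrictMono σ ∧ σ 0 = 0 ∧ Tendsto σ atTop (𝓝 1) ∧
    ∀ i, ContDiffOn ℝ 1 γ (Icc (σ i) (σ (i + 1))) ∧
      ∀ s ∈ Icc (σ i) (σ (i + 1)), derivWithin γ (Icc (σ i) (σ (i + 1))) s ≠ 0

/-- `φ` is the continuous choice of `arg (t - a)` along the contour `t = γ s`, `0 < s < 1`,
which tends to `ϖ` as `t → a`. Thus `ϖ` is an angle of slope of the contour at `a`. -/
structure IsArgAlong (γ : ℝ → ℂ) (a : ℂ) (ϖ : ℝ) (φ : ℝ → ℝ) : Prop where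
  polar : ∀ s ∈ Ioo (0 : ℝ) 1, γ s - a = (‖γ s - a‖ : ℂ) * Complex.exp ((φ s : ℂ) * I)
  cont : ContinuousOn φ (Ioo (0 : ℝ) 1)
  slope : Tendsto φ (𝓝[>] (0 : ℝ)) (𝓝 ϖ)

/-- As `t = γ s → a` along the contour, `f t = ∑ n, c n * (t - a) ^ (n + e)`, a convergent
series, where the powers are formed with the phase `φ` of `t - a`. -/
def HasExpansion (γ : ℝ → ℂ) (a : ℂ) (φ : ℝ → ℝ) (e : ℂ) (c : ℕ → ℂ) (f : ℂ → ℂ) : Prop :=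
  ∀ᶠ s in 𝓝[>] (0 : ℝ),
    HasSum (fun n : ℕ => c n * polarPow ‖γ s - a‖ (φ s) ((n : ℂ) + e)) (f (γ s))

/-- The integrand of `∫ exp (-z p(t) + z ^ κ r(t)) q(t) dt`, `z = ρ * exp (i θ)`, after the
substitution `t = γ s`; here `z ^ κ` has phase `κ θ`. -/
def integrand (p q r : ℂ → ℂ) (γ : ℝ → ℂ) (κ ρ θ : ℝ) (s : ℝ) : ℂ :=
  Complex.exp (-((ρ : ℂ) * Complex.exp ((θ : ℂ) * I)) * p (γ s) + polarPow ρ θ κ * r (γ s))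
    * q (γ s) * deriv γ s

/-- The contour integral `I(z) = ∫_a^b exp (-z p(t) + z ^ κ r(t)) q(t) dt`,
`z = ρ * exp (i θ)`. -/
def contourIntegral (p q r : ℂ → ℂ) (γ : ℝ → ℂ) (κ ρ θ : ℝ) : ℂ :=
  ∫ s in Ioo (0 : ℝ) 1, integrand p q r γ κ ρ θ s

/-- The value `ϖ₀` of `arg p₀` with `|ϖ₀ + θ + μ ϖ| ≤ π / 2` for all `θ ∈ [θ₁, θ₂]`. -/
def IsLeadingArg (p₀ : ℂ) (μ ϖ θ₁ θ₂ ϖ₀ : ℝ) : Prop :=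
  p₀ = (‖p₀‖ : ℂ) * Complex.exp ((ϖ₀ : ℂ) * I) ∧
    ∀ θ ∈ Icc θ₁ θ₂, |ϖ₀ + θ + μ * ϖ| ≤ Real.pi / 2

/-- The residue of `f` at an isolated singularity `a`: the value of
`(2 π i)⁻¹ ∮ f` over all sufficiently small positively oriented circles about `a`. -/
def residue (f : ℂ → ℂ) (a : ℂ) : ℂ :=
  limUnder (𝓝[>] (0 : ℝ)) fun ε : ℝ => (2 * (Real.pi : ℂ) * I)⁻¹ * ∮ x in C(a, ε), f x

/-- The sum of the power series with coefficients `c`. -/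
def powerSum (c : ℕ → ℂ) (x : ℂ) : ℂ := ∑' n : ℕ, c n * x ^ n

/-- If `p(t) - p(a) = ∑ n, pc n * (t - a) ^ (n + μ)`, this is the analytic function
`(p(t) - p(a)) ^ e / (t - a) ^ (μ e)` of `x = t - a` near `0`, with the branch that takes the
value `p₀ ^ e = exp (e (log |p₀| + i ϖ₀))` at `x = 0`. -/
def phasePow (pc : ℕ → ℂ) (ϖ₀ : ℝ) (e x : ℂ) : ℂ :=
  polarPow ‖pc 0‖ ϖ₀ e * (powerSum pc x / pc 0) ^ e

/-- `b_n = (1 / μ) Res_{t = a} [q(t) / (p(t) - p(a)) ^ ((n + lam) / μ)]`, written in the local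
variable `x = t - a`: since `q(t) = (t - a) ^ (lam - 1) * powerSum qc (t - a)`, the fractional
powers of `t - a` combine to `x ^ (-(n + 1))`. -/
def coeffB (pc qc : ℕ → ℂ) (μ : ℝ) (lam : ℂ) (ϖ₀ : ℝ) (n : ℕ) : ℂ :=
  (1 / (μ : ℂ)) *
    residue (fun x => powerSum qc x / (x ^ (n + 1) * phasePow pc ϖ₀ (((n : ℂ) + lam) / μ) x)) 0

/-- `c_n = (1 / μ) Res_{t = a} [p'(t) r(t) / (p(t) - p(a)) ^ ((n + ν) / μ + 1)]`, written in the
local variable `x = t - a`: here `p'(t) = ∑ k, (k + μ) * pc k * (t - a) ^ (k + μ - 1)` and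
`r(t) = (t - a) ^ ν * powerSum rc (t - a)`, and the fractional powers of `t - a` combine to
`x ^ (-(n + 1))`. -/
def coeffC (pc rc : ℕ → ℂ) (μ ν : ℝ) (ϖ₀ : ℝ) (n : ℕ) : ℂ :=
  (1 / (μ : ℂ)) *
    residue (fun x => powerSum (fun k => ((k : ℂ) + μ) * pc k) x * powerSum rc x /
      (x ^ (n + 1) * phasePow pc ϖ₀ (((n : ℂ) + ν) / μ + 1) x)) 0

/-- The partial ordinary Bell polynomial `B_{n,m}(c 1, …, c (n - m + 1))`: the coefficient of
`x ^ n` in `(c 1 * x + c 2 * x ^ 2 + ⋯) ^ m`. -/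
def ordBell (c : ℕ → ℂ) (n m : ℕ) : ℂ :=
  PowerSeries.coeff n ((PowerSeries.mk fun k => if k = 0 then 0 else c k) ^ m)

/-- `f_{n,m} = (1 / m!) ∑_{j = m}^n b_{n - j} B_{j,m}(c_1, …, c_{j - m + 1})`. -/
def coeffF (pc qc rc : ℕ → ℂ) (μ ν : ℝ) (lam : ℂ) (ϖ₀ : ℝ) (n m : ℕ) : ℂ :=
  (1 / (m.factorial : ℂ)) * ∑ j ∈ Finset.Icc m n,
    coeffB pc qc μ lam ϖ₀ (n - j) * ordBell (coeffC pc rc μ ν ϖ₀) j m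

/-- The partial sum over `n < N` of
`∑ n, z ^ (-(n + lam) / μ) * ∑_{m ≤ n} f_{n,m} Fi(ν / μ, (n + lam + m ν) / μ; r₀ / p₀ ^ (ν / μ))`,
`z = ρ * exp (i θ)`. -/
def partialSum (pc qc rc : ℕ → ℂ) (μ ν : ℝ) (lam : ℂ) (ϖ₀ : ℝ) (N : ℕ) (ρ θ : ℝ) : ℂ :=
  ∑ n ∈ Finset.range N, (1 / polarPow ρ θ (((n : ℂ) + lam) / μ)) *
    ∑ m ∈ Finset.range (n + 1), coeffF pc qc rc μ ν lam ϖ₀ n m *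
      faxen (ν / μ) (((n : ℂ) + lam + (m : ℂ) * ν) / μ)
        (rc 0 / polarPow ‖pc 0‖ ϖ₀ ((ν / μ : ℝ) : ℂ))

end FaxenExpansion

end

noncomputable section

namespace FaxenExpansion

/-! Everything near `a` is written with one continuous logarithm Λ of p(t) - p(a) along the contour.
Put W = log z + Λ, κ = ν/μ, y = exp(Λ/μ) and A = exp(κW). Then q dt = Q y^λ dΛ and r = y^ν (x + R),
where x = r₀/p₀^κ and where R and Q are analytic in t - a, with R = O(y). Up to exp(-z p(a)) the
integrand is exp(-e^W + xA) · exp(AR) Q y^λ dΛ.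

Expand exp(AR) Q in powers of y, with coefficients polynomial in A. The error is at most K|y|^N
exp(K|A|), uniformly in A (`HasTrunc.exists_norm_exp_mul_sub_le`); as κ < 1, the decay of exp(-e^W)
absorbs exp(K|A|). A Gamma integral then gives the order |z|^(-(N + Re λ)/μ). Each term y^n A^m y^λ
equals z^(-(n+λ)/μ) exp(βW) with β = (n+λ)/μ + mκ, so it yields Faxén's integrand in the variable W.
That integrand has an entire primitive, which tends to 0 at the left end of the strip |Im W| ≤ d <
π/2 and to Faxén's integral at the right end, with an error below every power of e^(Re W)
(`exists_primitive_logIntegrand`). Integrating a term therefore means evaluating the primitive at an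
endpoint, and no contour is deformed.

The coefficients are those of analytic functions expanded in powers of the local coordinate h =
(p(t) - p(a))^(1/μ). They are found by repeated division by h, and they equal the stated residues
because A h'/h^(n+1) is a residue form (`eventually_circleIntegral_eq`).

Away from `a`, the integrand is compared with the one at the single point Z exp(iθ₁): the quotient
is exponentially small in |z|, since Re(e^(iθ)(p - p(a))) ≥ |p - p(a)| sin δ and r = O(p - p(a))
(`exists_tail_bound`). -/

theorem exists_mul_rpow_le_mul_add {κ K c : ℝ} (hκ0 : 0 ≤ κ) (hκ1 : κ < 1) (hK : 0 ≤ K)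
    (hc : 0 < c) : ∃ C : ℝ, 0 ≤ C ∧ ∀ t : ℝ, 0 < t → K * t ^ κ ≤ c * t + C := by
  -- `T` is the point where K t^κ and c t agree; beyond it the linear term dominates.
  set T : ℝ := (K / c) ^ (1 / (1 - κ)) with hT
  have hT0 : 0 ≤ T := Real.rpow_nonneg (by positivity) _
  refine ⟨K * T ^ κ, mul_nonneg hK (Real.rpow_nonneg hT0 _), fun t ht => ?_⟩
  rcases le_total t T with h | h
  · have : K * t ^ κ ≤ K * T ^ κ := by gcongr
    nlinarith [mul_pos hc ht]
  · have h1 : K / c ≤ t ^ (1 - κ) := by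
      calc K / c = T ^ (1 - κ) := by
            rw [hT, ← Real.rpow_mul (by positivity), one_div_mul_cancel (by linarith),
              Real.rpow_one]
        _ ≤ t ^ (1 - κ) := Real.rpow_le_rpow hT0 h (by linarith)
    have h2 : t = t ^ (1 - κ) * t ^ κ := by
      rw [← Real.rpow_add ht]; simp
    have h3 : K * t ^ κ ≤ c * t := by
      rw [div_le_iff₀ hc] at h1
      calc K * t ^ κ ≤ (t ^ (1 - κ) * c) * t ^ κ := by gcongr
        _ = c * (t ^ (1 - κ) * t ^ κ) := by ring
        _ = c * t := by rw [← h2]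
    have := mul_nonneg hK (Real.rpow_nonneg hT0 κ)
    linarith

theorem exists_rpow_mul_exp_neg_le {M c : ℝ} (hM : 0 ≤ M) (hc : 0 < c) :
    ∃ C : ℝ, 0 < C ∧ ∀ t : ℝ, 0 < t → t ^ M * Real.exp (-(c * t)) ≤ C := by
  rcases hM.eq_or_lt with rfl | hM
  · refine ⟨1, one_pos, fun t ht => ?_⟩
    simp only [Real.rpow_zero, one_mul, Real.exp_le_one_iff]
    nlinarith [mul_pos hc ht]
  -- The constant is (M/c)^M; it comes from log u ≤ u - 1 at u = ct/M.
  · refine ⟨Real.exp (-M * Real.log (c / M)), Real.exp_pos _, fun t ht => ?_⟩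
    rw [Real.rpow_def_of_pos ht, ← Real.exp_add, Real.exp_le_exp]
    have h := Real.log_le_sub_one_of_pos (show 0 < c / M * t by positivity)
    rw [Real.log_mul (by positivity) ht.ne'] at h
    have h2 : M * (Real.log (c / M) + Real.log t) ≤ M * (c / M * t - 1) := by gcongr
    have h3 : M * (c / M * t - 1) = c * t - M := by field_simp
    nlinarith

theorem norm_exp_real_mul (κ : ℝ) (W : ℂ) : ‖cexp (κ * W)‖ = ‖cexp W‖ ^ κ := by
  rw [norm_exp, norm_exp, ← Real.exp_mul]
  simp [mul_comm]

/-! ### Faxén's integral in the logarithmic variable -/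

/-- Faxén's integrand in the logarithmic variable. -/
def logIntegrand (κ : ℝ) (β x W : ℂ) : ℂ :=
  cexp (-cexp W + x * cexp (κ * W)) * cexp (β * W)

/-- Since κ < 1, half of the decay of exp(-e^W) absorbs the term v e^(κW), with a constant that
depends on v only through `K`. -/
theorem exists_norm_exp_neg_exp_le {κ c : ℝ} (hκ0 : 0 ≤ κ) (hκ1 : κ < 1) (hc : 0 < c)
    (K : ℝ) : ∃ C : ℝ, 0 < C ∧ ∀ W v : ℂ, ‖v‖ ≤ K → c * ‖cexp W‖ ≤ (cexp W).re →
      ‖cexp (-cexp W + v * cexp (κ * W))‖ ≤ C * Real.exp (-(c / 2 * ‖cexp W‖)) := by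
  obtain ⟨C, hC, h⟩ := exists_mul_rpow_le_mul_add hκ0 hκ1 (le_max_right K 0) (half_pos hc)
  refine ⟨Real.exp C, Real.exp_pos _, fun W v hv hW => ?_⟩
  rw [norm_exp, ← Real.exp_add, Real.exp_le_exp, add_re, neg_re]
  have h1 : (v * cexp (κ * W)).re ≤ max K 0 * ‖cexp W‖ ^ κ := by
    refine (re_le_norm _).trans ?_
    rw [norm_mul, norm_exp_real_mul]
    gcongr
    exact hv.trans (le_max_left _ _)
  have h2 := h ‖cexp W‖ (by simp)
  linarith

theorem cos_mul_norm_exp_le_re {d : ℝ} (hd : d ≤ Real.pi / 2) {W : ℂ} (hW : |W.im| ≤ d) :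
    Real.cos d * ‖cexp W‖ ≤ (cexp W).re := by
  rw [norm_exp, exp_re, mul_comm]
  gcongr
  rw [← Real.cos_abs W.im]
  exact Real.cos_le_cos_of_nonneg_of_le_pi (abs_nonneg _) (by linarith [Real.pi_pos]) hW

/-- The surplus power |e^W|^(Re β - e) is absorbed by the exponential decay, so `e` is free below Re
β: `e` = Re β serves at the left end of the strip, and very negative `e` at the right end. -/
theorem exists_norm_logIntegrand_le {κ d : ℝ} (hκ0 : 0 ≤ κ) (hκ1 : κ < 1) (hd0 : 0 ≤ d)
    (hd : d < Real.pi / 2) (β x : ℂ) {e : ℝ} (he : e ≤ β.re) :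
    ∃ C : ℝ, 0 < C ∧ ∀ W : ℂ, |W.im| ≤ d → ‖logIntegrand κ β x W‖ ≤ C * Real.exp (e * W.re) := by
  have hc : 0 < Real.cos d := Real.cos_pos_of_mem_Ioo ⟨by linarith, hd⟩
  obtain ⟨C₁, hC₁, h₁⟩ := exists_norm_exp_neg_exp_le hκ0 hκ1 hc ‖x‖
  obtain ⟨C₂, hC₂, h₂⟩ := exists_rpow_mul_exp_neg_le (sub_nonneg.2 he) (half_pos hc)
  refine ⟨C₁ * C₂ * Real.exp (|β.im| * d), by positivity, fun W hW => ?_⟩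
  rw [logIntegrand, norm_mul]
  have h3 := h₁ W x le_rfl (cos_mul_norm_exp_le_re hd.le hW)
  have h4 := h₂ ‖cexp W‖ (by simp)
  have h5 : ‖cexp (β * W)‖ ≤
      ‖cexp W‖ ^ (β.re - e) * Real.exp (e * W.re) * Real.exp (|β.im| * d) := by
    rw [norm_exp, norm_exp, ← Real.exp_mul, ← Real.exp_add, ← Real.exp_add, Real.exp_le_exp, mul_re]
    have : -(β.im * W.im) ≤ |β.im| * d := by
      refine (neg_le_abs _).trans ?_
      rw [abs_mul]; gcongr
    linarith
  calc _ ≤ (C₁ * Real.exp (-(Real.cos d / 2 * ‖cexp W‖))) *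
        (‖cexp W‖ ^ (β.re - e) * Real.exp (e * W.re) * Real.exp (|β.im| * d)) := by gcongr
    _ = C₁ * (‖cexp W‖ ^ (β.re - e) * Real.exp (-(Real.cos d / 2 * ‖cexp W‖))) *
        Real.exp (e * W.re) * Real.exp (|β.im| * d) := by ring
    _ ≤ C₁ * C₂ * Real.exp (e * W.re) * Real.exp (|β.im| * d) := by gcongr
    _ = _ := by ring

theorem differentiable_logIntegrand (κ : ℝ) (β x : ℂ) : Differentiable ℂ (logIntegrand κ β x) := by
  unfold logIntegrand; fun_prop

/-- The substitution t = e^τ turns t^(β-1) dt into e^(βτ) dτ. -/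
theorem integral_logIntegrand (κ : ℝ) (β x : ℂ) :
    ∫ τ : ℝ, logIntegrand κ β x τ = faxen κ β x := by
  have h := integral_image_eq_integral_abs_deriv_smul (f := Real.exp) (f' := Real.exp)
    (s := univ) MeasurableSet.univ
    (fun x _ => (Real.hasDerivAt_exp x).hasDerivWithinAt) Real.exp_injective.injOn
    (fun t => cexp (-(t : ℂ) + x * ((t ^ κ : ℝ) : ℂ)) * (t : ℂ) ^ (β - 1))
  rw [image_univ, Real.range_exp] at h
  rw [faxen, h, setIntegral_univ]
  congr 1
  ext τ
  rw [abs_of_pos (Real.exp_pos _), logIntegrand, real_smul, ← Real.exp_mul,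
    cpow_def_of_ne_zero (by simp), ← ofReal_log (Real.exp_pos _).le, Real.log_exp,
    ofReal_exp τ, ofReal_exp]
  rw [show cexp (β * τ) = cexp τ * cexp (τ * (β - 1)) by rw [← Complex.exp_add]; ring_nf]
  push_cast
  ring_nf

theorem integrableOn_Iic_logIntegrand {κ : ℝ} (hκ0 : 0 ≤ κ) (hκ1 : κ < 1) {β : ℂ} (hβ : 0 < β.re)
    (x : ℂ) (X : ℝ) : IntegrableOn (fun τ : ℝ => logIntegrand κ β x τ) (Iic X) := by
  obtain ⟨C, _, h⟩ := exists_norm_logIntegrand_le hκ0 hκ1 le_rfl (by positivity) β x le_rfl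
  refine Integrable.mono' ((integrableOn_exp_mul_Iic hβ X).const_mul C) ?_ ?_
  · exact ((differentiable_logIntegrand κ β x).continuous.comp
      continuous_ofReal).aestronglyMeasurable
  · exact ae_of_all _ fun τ => by simpa using h (τ : ℂ) (by simp)

theorem integrableOn_Ioi_logIntegrand {κ : ℝ} (hκ0 : 0 ≤ κ) (hκ1 : κ < 1) {β : ℂ} (hβ : 0 < β.re)
    (x : ℂ) (X : ℝ) : IntegrableOn (fun τ : ℝ => logIntegrand κ β x τ) (Ioi X) := by
  obtain ⟨C, _, h⟩ := exists_norm_logIntegrand_le hκ0 hκ1 le_rfl (by positivity) β x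
    (show (-1 : ℝ) ≤ β.re by linarith)
  refine Integrable.mono' ((integrableOn_exp_mul_Ioi (a := -1) (by norm_num) X).const_mul C) ?_ ?_
  · exact ((differentiable_logIntegrand κ β x).continuous.comp
      continuous_ofReal).aestronglyMeasurable
  · exact ae_of_all _ fun τ => by simpa using h (τ : ℂ) (by simp)

/-- The primitive of Faxén's integrand in the logarithmic variable, vanishing at `-∞`. -/
theorem exists_primitive_logIntegrand {κ d : ℝ} (hκ0 : 0 ≤ κ) (hκ1 : κ < 1) (hd0 : 0 ≤ d)
    (hd : d < Real.pi / 2) {β : ℂ} (hβ : 0 < β.re) (x : ℂ) :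
    ∃ G : ℂ → ℂ, (∀ W, HasDerivAt G (logIntegrand κ β x W) W) ∧
      (∃ C : ℝ, 0 < C ∧ ∀ W : ℂ, |W.im| ≤ d → ‖G W‖ ≤ C * Real.exp (β.re * W.re)) ∧
      (∀ M : ℝ, 0 < M → ∃ C : ℝ, 0 < C ∧ ∀ W : ℂ, |W.im| ≤ d →
        ‖G W - faxen κ β x‖ ≤ C * Real.exp (-M * W.re)) := by
  obtain ⟨G₀, hG₀⟩ := (differentiable_logIntegrand κ β x).isExactOn_univ
  replace hG₀ : ∀ W, HasDerivAt G₀ (logIntegrand κ β x W) W := fun W => hG₀ W (mem_univ _)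
  have hline : ∀ τ : ℝ, HasDerivAt (fun τ : ℝ => G₀ τ) (logIntegrand κ β x τ) τ := fun τ =>
    (hG₀ τ).comp_ofReal
  have hbot := tendsto_limUnder_of_hasDerivAt_of_integrableOn_Iic (a := 0)
    (fun τ _ => hline τ) (integrableOn_Iic_logIntegrand hκ0 hκ1 hβ x 0)
  have htop := tendsto_limUnder_of_hasDerivAt_of_integrableOn_Ioi (a := 0)
    (fun τ _ => hline τ) (integrableOn_Ioi_logIntegrand hκ0 hκ1 hβ x 0)
  set m := limUnder atBot (fun τ : ℝ => G₀ τ)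
  set n := limUnder atTop (fun τ : ℝ => G₀ τ)
  have hint : Integrable (fun τ : ℝ => logIntegrand κ β x τ) := by
    rw [← integrableOn_univ, ← Iic_union_Ioi (a := (0 : ℝ))]
    exact (integrableOn_Iic_logIntegrand hκ0 hκ1 hβ x 0).union
      (integrableOn_Ioi_logIntegrand hκ0 hκ1 hβ x 0)
  have hfaxen : faxen κ β x = n - m := by
    rw [← integral_logIntegrand]
    exact integral_of_hasDerivAt_of_tendsto hline hint hbot htop
  -- This reduces the strip to the real line: on the vertical segment from Re W to W the bound for
  -- the derivative is constant, and the segment has length at most `d`.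
  have hvert : ∀ (e C : ℝ), (∀ W : ℂ, |W.im| ≤ d →
      ‖logIntegrand κ β x W‖ ≤ C * Real.exp (e * W.re)) → ∀ W : ℂ, |W.im| ≤ d →
      ‖G₀ W - G₀ W.re‖ ≤ C * Real.exp (e * W.re) * d := by
    intro e C h W hW
    have h1 : ‖G₀ W - G₀ W.re‖ ≤ C * Real.exp (e * W.re) * ‖W - (W.re : ℂ)‖ := by
      refine Convex.norm_image_sub_le_of_norm_hasDerivWithin_le
        (f' := logIntegrand κ β x) (s := segment ℝ (W.re : ℂ) W)
        (fun V _ => (hG₀ V).hasDerivWithinAt) (fun V hV => ?_) (convex_segment _ _)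
        (left_mem_segment _ _ _) (right_mem_segment _ _ _)
      obtain ⟨a, b, ha, hb, hab, rfl⟩ := hV
      have hre : (a • (W.re : ℂ) + b • W).re = W.re := by
        simp [← add_mul, hab]
      have him : (a • (W.re : ℂ) + b • W).im = b * W.im := by simp
      refine (h _ ?_).trans (by rw [hre])
      rw [him, abs_mul, abs_of_nonneg hb]
      nlinarith [abs_nonneg W.im]
    have h2 : ‖W - (W.re : ℂ)‖ = |W.im| := by
      have : W - (W.re : ℂ) = W.im * I := by
        apply Complex.ext <;> simp
      rw [this]; simp
    rw [h2] at h1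
    have h0 : 0 ≤ C * Real.exp (e * W.re) := (norm_nonneg _).trans (h W hW)
    exact h1.trans (by gcongr)
  refine ⟨fun W => G₀ W - m, fun W => (hG₀ W).sub_const m, ?_, fun M hM => ?_⟩
  · obtain ⟨C, hC, h⟩ := exists_norm_logIntegrand_le hκ0 hκ1 hd0 hd β x le_rfl
    refine ⟨C * d + C / β.re, by positivity, fun W hW => ?_⟩
    have h1 : ‖G₀ W.re - m‖ ≤ C * (Real.exp (β.re * W.re) / β.re) := by
      rw [← integral_Iic_of_hasDerivAt_of_tendsto' (fun τ _ => hline τ)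
        (integrableOn_Iic_logIntegrand hκ0 hκ1 hβ x W.re) hbot, ← integral_exp_mul_Iic hβ,
        ← integral_const_mul]
      refine norm_integral_le_of_norm_le ((integrableOn_exp_mul_Iic hβ _).const_mul C)
        (ae_of_all _ fun τ => ?_)
      simpa using h (τ : ℂ) (by simpa using hd0)
    have h2 := hvert _ _ h W hW
    calc ‖G₀ W - m‖ = ‖(G₀ W - G₀ W.re) + (G₀ W.re - m)‖ := by ring_nf
      _ ≤ _ := (norm_add_le _ _).trans (add_le_add h2 h1)
      _ = _ := by ring
  -- The exponent -M is admissible for every M > 0; this makes the error at the right end smaller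
  -- than any power of e^(Re W).
  · obtain ⟨C, hC, h⟩ := exists_norm_logIntegrand_le hκ0 hκ1 hd0 hd β x
      (show -M ≤ β.re by linarith)
    refine ⟨C * d + C / M, by positivity, fun W hW => ?_⟩
    have h1 : ‖n - G₀ W.re‖ ≤ C * (-Real.exp (-M * W.re) / -M) := by
      rw [← integral_Ioi_of_hasDerivAt_of_tendsto' (fun τ _ => hline τ)
        (integrableOn_Ioi_logIntegrand hκ0 hκ1 hβ x W.re) htop,
        ← integral_exp_mul_Ioi (neg_lt_zero.2 hM), ← integral_const_mul]
      refine norm_integral_le_of_norm_le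
        ((integrableOn_exp_mul_Ioi (neg_lt_zero.2 hM) _).const_mul C) (ae_of_all _ fun τ => ?_)
      simpa using h (τ : ℂ) (by simpa using hd0)
    have h2 := hvert _ _ h W hW
    calc ‖G₀ W - m - faxen κ β x‖ = ‖(G₀ W - G₀ W.re) - (n - G₀ W.re)‖ := by
          rw [hfaxen]; ring_nf
      _ ≤ _ := (norm_sub_le _ _).trans (add_le_add h2 h1)
      _ = _ := by field_simp

/-! ### Power series, expansion in a local coordinate, and residues -/

theorem hasFPowerSeriesAt_powerSum {c : ℕ → ℂ} {x₀ : ℂ} (hx₀ : x₀ ≠ 0)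
    (hs : Summable fun n => c n * x₀ ^ n) :
    HasFPowerSeriesAt (powerSum c) (FormalMultilinearSeries.ofScalars ℂ c) 0 := by
  set P := FormalMultilinearSeries.ofScalars ℂ c
  have hr : ((‖x₀‖₊ : NNReal) : ENNReal) ≤ P.radius := by
    refine P.le_radius_of_tendsto (l := 0) ?_
    have h := hs.tendsto_atTop_zero.norm
    simpa [P] using h
  have hpos : 0 < P.radius := lt_of_lt_of_le (by simpa using hx₀) hr
  have hsum : P.sum = powerSum c := by
    ext x
    simp [FormalMultilinearSeries.sum, powerSum, P, mul_comm]
  rw [← hsum]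
  exact ⟨_, P.hasFPowerSeriesOnBall hpos⟩

theorem powerSum_zero (c : ℕ → ℂ) : powerSum c 0 = c 0 := by
  rw [powerSum, tsum_eq_single 0 (by intro n hn; simp [hn])]
  simp

theorem deriv_powerSum_zero {c : ℕ → ℂ} {x₀ : ℂ} (hx₀ : x₀ ≠ 0)
    (hs : Summable fun n => c n * x₀ ^ n) : deriv (powerSum c) 0 = c 1 := by
  rw [(hasFPowerSeriesAt_powerSum hx₀ hs).deriv]
  simp

/-- Termwise differentiation in the disc of convergence; needed for the series of p' inside
`coeffC`. -/
theorem eventually_powerSum_deriv {c : ℕ → ℂ} {x₀ : ℂ} (hx₀ : x₀ ≠ 0)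
    (hs : Summable fun n => c n * x₀ ^ n) (μ : ℂ) :
    ∀ᶠ x in 𝓝 (0 : ℂ), powerSum (fun k => ((k : ℂ) + μ) * c k) x
      = μ * powerSum c x + x * deriv (powerSum c) x := by
  have hA := (hasFPowerSeriesAt_powerSum hx₀ hs)
  obtain ⟨R, hR⟩ := hA
  obtain ⟨r, hr0, hrR⟩ := ENNReal.lt_iff_exists_nnreal_btwn.1 hR.r_pos
  have hr0' : (0 : ℝ) < r := by exact_mod_cast hr0
  have hu : Summable fun n => ‖c n‖ * (r : ℝ) ^ n := by
    have := (FormalMultilinearSeries.ofScalars ℂ c).summable_norm_mul_pow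
      (lt_of_lt_of_le hrR hR.r_le)
    simpa using this
  filter_upwards [Metric.ball_mem_nhds (0 : ℂ) hr0'] with x hx
  have hx' : ‖x‖ < r := by simpa using hx
  have hle : ∀ (n : ℕ) (w : ℂ), w ∈ Metric.ball (0 : ℂ) r → ‖c n * w ^ n‖ ≤ ‖c n‖ * (r : ℝ) ^ n := by
    intro n w hw
    rw [norm_mul, norm_pow]
    have : ‖w‖ ≤ r := by simpa using (show ‖w‖ < r by simpa using hw).le
    gcongr
  have h1 : HasSum (fun n => c n * x ^ n) (powerSum c x) :=
    (Summable.of_norm_bounded hu fun n => hle n x hx).hasSum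
  have h2 : HasSum (fun n => deriv (fun w : ℂ => c n * w ^ n) x) (deriv (powerSum c) x) :=
    hasSum_deriv_of_summable_norm hu (fun n => by fun_prop) Metric.isOpen_ball hle hx
  have h3 := (h1.mul_left μ).add (h2.mul_left x)
  rw [← h3.tsum_eq, powerSum]
  congr 1
  ext n
  rw [deriv_const_mul _ (by fun_prop), deriv_pow_field]
  rcases n with _ | n
  · simp
  · simp [pow_succ]; ring

/-- The successive remainders of the expansion of `A` in powers of `h x = x * k x`:
`A = ∑ j < n, quotSeq k A j 0 * h ^ j + h ^ n * quotSeq k A n`. -/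
def quotSeq (k A : ℂ → ℂ) : ℕ → ℂ → ℂ
  | 0 => A
  | n + 1 => fun x => dslope (quotSeq k A n) 0 x / k x

theorem analyticAt_dslope {A : ℂ → ℂ} (hA : AnalyticAt ℂ A 0) : AnalyticAt ℂ (dslope A 0) 0 := by
  obtain ⟨P, hP⟩ := hA
  exact ⟨_, hP.has_fpower_series_dslope_fslope⟩

theorem analyticAt_quotSeq {k A : ℂ → ℂ} (hk : AnalyticAt ℂ k 0) (hk0 : k 0 ≠ 0)
    (hA : AnalyticAt ℂ A 0) (n : ℕ) : AnalyticAt ℂ (quotSeq k A n) 0 := by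
  induction n with
  | zero => exact hA
  | succ n ih => exact (analyticAt_dslope ih).div hk hk0

theorem eq_add_mul_quotSeq_one {k A : ℂ → ℂ} {x : ℂ} (hx : k x ≠ 0) (n : ℕ) :
    quotSeq k A n x = quotSeq k A n 0 + x * k x * quotSeq k A (n + 1) x := by
  have h := sub_smul_dslope (quotSeq k A n) 0 x
  rw [sub_zero, smul_eq_mul] at h
  rw [quotSeq]
  field_simp
  rw [h]; ring

/-- Iterated division by h = x k(x) gives the expansion in powers of h with an explicit remainder,
so the inverse function of h is never needed. -/
theorem eq_sum_add_quotSeq {k A : ℂ → ℂ} {x : ℂ} (hx : k x ≠ 0) (n : ℕ) :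
    A x = ∑ j ∈ Finset.range n, quotSeq k A j 0 * (x * k x) ^ j
      + (x * k x) ^ n * quotSeq k A n x := by
  induction n with
  | zero => simp [quotSeq]
  | succ n ih =>
    rw [ih, Finset.sum_range_succ, eq_add_mul_quotSeq_one hx n]
    ring

theorem quotSeq_one_apply_zero (k A : ℂ → ℂ) : quotSeq k A 1 0 = deriv A 0 / k 0 := by
  simp [quotSeq, dslope_same]

theorem quotSeq_quotSeq_one (k A : ℂ → ℂ) (n : ℕ) :
    quotSeq k (quotSeq k A 1) n = quotSeq k A (n + 1) := by
  induction n with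
  | zero => rfl
  | succ n ih => rw [quotSeq, ih]; rfl

/-- With h = x k, the numerator contains h' = k + x k'. Write A = A(0) + h A₁: the part A(0)
h'/h^(n+2) is exact, and A₁ h'/h^(n+1) is the previous case for A₁, which is why the induction keeps
`A` general. The case n = 0 is Cauchy's formula for A h'/k. -/
theorem eventually_circleIntegral_eq {k : ℂ → ℂ} (hk : AnalyticAt ℂ k 0) (hk0 : k 0 ≠ 0) (n : ℕ) :
    ∀ {A : ℂ → ℂ}, AnalyticAt ℂ A 0 → ∀ᶠ ε in 𝓝[>] (0 : ℝ),
      ∮ x in C(0, ε), A x * (k x + x * deriv k x) / (x * k x) ^ (n + 1)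
        = 2 * Real.pi * I * quotSeq k A n 0 := by
  have hkn := hk.eventually_analyticAt.and (hk.continuousAt.eventually_ne hk0)
  have hkd : AnalyticAt ℂ (fun x => k x + x * deriv k x) 0 :=
    hk.add (analyticAt_id.mul hk.deriv)
  induction n with
  | zero =>
    intro A hA
    have hG : AnalyticAt ℂ (fun x => A x * (k x + x * deriv k x) / k x) 0 :=
      (hA.mul hkd).div hk hk0
    obtain ⟨r, hr, hball⟩ := Metric.eventually_nhds_iff_ball.1 (hG.eventually_analyticAt.and hkn)
    filter_upwards [Ioo_mem_nhdsGT hr] with ε hε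
    have hd : DifferentiableOn ℂ (fun x => A x * (k x + x * deriv k x) / k x)
        (Metric.closedBall 0 ε) := fun x hx =>
      ((hball x (Metric.closedBall_subset_ball hε.2 hx)).1.differentiableAt).differentiableWithinAt
    have h := hd.circleIntegral_sub_inv_smul (w := 0) (by simpa using hε.1)
    simp only [sub_zero, smul_eq_mul, zero_mul, add_zero, mul_div_cancel_right₀ _ hk0] at h
    rw [quotSeq, ← h]
    refine circleIntegral.integral_congr hε.1.le fun x hx => ?_
    simp only [zero_add, pow_one]
    rw [div_mul_eq_div_div, div_right_comm, div_eq_inv_mul]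
  | succ n ih =>
    intro A hA
    have hA1 := analyticAt_quotSeq hk hk0 hA 1
    obtain ⟨r, hr, hball⟩ := Metric.eventually_nhds_iff_ball.1 (hA1.eventually_analyticAt.and
      (hkn.and hkd.eventually_analyticAt))
    filter_upwards [Ioo_mem_nhdsGT hr, ih hA1] with ε hε hI
    rw [quotSeq_quotSeq_one] at hI
    have hsph : ∀ x ∈ Metric.sphere (0 : ℂ) ε, x ∈ Metric.ball (0 : ℂ) r ∧ x ≠ 0 := by
      intro x hx
      rw [mem_sphere_zero_iff_norm] at hx
      exact ⟨by simpa [hx] using hε.2, fun h0 => by rw [h0] at hx; simp at hx; linarith [hε.1]⟩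
    have hne : ∀ x ∈ Metric.sphere (0 : ℂ) ε, x * k x ≠ 0 := fun x hx =>
      mul_ne_zero (hsph x hx).2 (hball x (hsph x hx).1).2.1.2
    have hderiv : ∀ x ∈ Metric.sphere (0 : ℂ) ε,
        HasDerivAt (fun x => -(A 0) / (n + 1) * ((x * k x) ^ (n + 1))⁻¹)
          (A 0 * (k x + x * deriv k x) / (x * k x) ^ (n + 1 + 1)) x := by
      intro x hx
      have hkx := (hball x (hsph x hx).1).2.1.1.differentiableAt.hasDerivAt
      have h0 : HasDerivAt (fun x => x * k x) (k x + x * deriv k x) x := by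
        simpa using (hasDerivAt_id x).fun_mul hkx
      have h1 := (h0.fun_pow (n + 1)).fun_inv (pow_ne_zero _ (hne x hx))
      refine (h1.const_mul (-(A 0) / ((n : ℂ) + 1))).congr_deriv ?_
      have hn : (n : ℂ) + 1 ≠ 0 := by exact_mod_cast n.succ_ne_zero
      have := hne x hx
      generalize x * k x = h at *
      push_cast
      field_simp
      ring
    have hcont : ∀ m : ℕ, ∀ D : ℂ → ℂ, ContinuousOn D (Metric.sphere 0 ε) →
        CircleIntegrable (fun x => D x * (k x + x * deriv k x) / (x * k x) ^ m) 0 ε := by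
      intro m D hD
      refine ContinuousOn.circleIntegrable hε.1.le ?_
      refine (hD.mul fun x hx => ?_).div ?_ fun x hx => pow_ne_zero _ (hne x hx)
      · exact (hball x (hsph x hx).1).2.2.continuousAt.continuousWithinAt
      · exact (continuousOn_id.mul fun x hx =>
          (hball x (hsph x hx).1).2.1.1.continuousAt.continuousWithinAt).pow m
    have hsplit : ∮ x in C(0, ε), A x * (k x + x * deriv k x) / (x * k x) ^ (n + 1 + 1)
        = ∮ x in C(0, ε), (A 0 * (k x + x * deriv k x) / (x * k x) ^ (n + 1 + 1)
          + quotSeq k A 1 x * (k x + x * deriv k x) / (x * k x) ^ (n + 1)) := by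
      refine circleIntegral.integral_congr hε.1.le fun x hx => ?_
      have h1 := eq_add_mul_quotSeq_one (A := A) (hball x (hsph x hx).1).2.1.2 0
      have h2 := hne x hx
      simp only [quotSeq.eq_1, zero_add] at h1
      rw [h1]
      generalize x * k x = h at *
      field_simp
      ring
    rw [hsplit, circleIntegral.integral_add (hcont _ _ continuousOn_const) (hcont _ _ fun x hx =>
      (hball x (hsph x hx).1).1.continuousAt.continuousWithinAt), hI,
      circleIntegral.integral_eq_zero_of_hasDerivWithinAt'
        (f := fun x => -(A 0) / (n + 1) * ((x * k x) ^ (n + 1))⁻¹), zero_add]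
    rw [abs_of_pos hε.1]
    exact fun x hx => (hderiv x hx).hasDerivWithinAt

/-- The circle integrals are constant for small radii, so the limit defining the residue is this
constant. -/
theorem residue_eq_of_eventuallyEq {k A f : ℂ → ℂ} (hk : AnalyticAt ℂ k 0) (hk0 : k 0 ≠ 0)
    (hA : AnalyticAt ℂ A 0) {μ : ℂ} {n : ℕ}
    (hf : ∀ᶠ x in 𝓝[≠] (0 : ℂ), f x = μ * (A x * (k x + x * deriv k x) / (x * k x) ^ (n + 1))) :
    residue f 0 = μ * quotSeq k A n 0 := by
  refine Tendsto.limUnder_eq (tendsto_const_nhds.congr' ?_)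
  rw [eventually_nhdsWithin_iff] at hf
  obtain ⟨r, hr, hball⟩ := Metric.eventually_nhds_iff_ball.1 hf
  filter_upwards [Ioo_mem_nhdsGT hr, eventually_circleIntegral_eq hk hk0 n hA] with ε hε hI
  have : ∮ x in C(0, ε), f x
      = ∮ x in C(0, ε), μ * (A x * (k x + x * deriv k x) / (x * k x) ^ (n + 1)) := by
    refine circleIntegral.integral_congr hε.1.le fun x hx => ?_
    rw [mem_sphere_zero_iff_norm] at hx
    refine hball x (by simpa [hx] using hε.2) ?_
    rintro rfl
    simp at hx; linarith [hε.1]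
  rw [this, circleIntegral.integral_const_mul, hI]
  have : (Real.pi : ℂ) ≠ 0 := by exact_mod_cast Real.pi_ne_zero
  field_simp

/-! ### The local coordinate (p(t) - p(a))^(1/μ) and the coefficients b, c, f -/

/-- The logarithm `log |c| + i ϖ` of `c` determined by the phase `ϖ`. -/
def phaseLog (c : ℂ) (ϖ : ℝ) : ℂ := (Real.log ‖c‖ : ℝ) + (ϖ : ℝ) * I

theorem exp_phaseLog {c : ℂ} {ϖ : ℝ} (hc : c ≠ 0) (h : c = (‖c‖ : ℂ) * cexp ((ϖ : ℂ) * I)) :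
    cexp (phaseLog c ϖ) = c := by
  rw [phaseLog, Complex.exp_add, ← ofReal_exp, Real.exp_log (norm_pos_iff.2 hc), ← h]

/-- The logarithm of `(p(t) - p(a)) / (t - a) ^ μ` as a function of `x = t - a`. -/
def localLog (pc : ℕ → ℂ) (ϖ : ℝ) (x : ℂ) : ℂ :=
  phaseLog (pc 0) ϖ + Complex.log (powerSum pc x / pc 0)

/-- `(p(t) - p(a)) ^ (1 / μ) / (t - a)` as a function of `x = t - a`. -/
def localRoot (pc : ℕ → ℂ) (ϖ μ : ℝ) (x : ℂ) : ℂ := cexp (localLog pc ϖ x / μ)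

/-- The generating function of `coeffB` as a function of `x = t - a`. -/
def seriesB (pc qc : ℕ → ℂ) (μ : ℝ) (lam : ℂ) (ϖ : ℝ) (x : ℂ) : ℂ :=
  powerSum qc x * cexp (-(lam / μ) * localLog pc ϖ x) / (μ + x * deriv (localLog pc ϖ) x)

/-- The generating function of `coeffC` as a function of `x = t - a`. -/
def seriesC (pc rc : ℕ → ℂ) (μ ν : ℝ) (ϖ : ℝ) (x : ℂ) : ℂ :=
  powerSum rc x * cexp (-(ν / μ) * localLog pc ϖ x)

section

variable {pc qc rc : ℕ → ℂ} {x₀ lam : ℂ} {ϖ μ ν : ℝ}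

theorem powerSum_div_mem_slitPlane (hp0 : pc 0 ≠ 0) :
    powerSum pc 0 / pc 0 ∈ slitPlane := by
  rw [powerSum_zero, div_self hp0]; exact one_mem_slitPlane

theorem analyticAt_localLog (hx₀ : x₀ ≠ 0) (hp : Summable fun n => pc n * x₀ ^ n)
    (hp0 : pc 0 ≠ 0) (ϖ : ℝ) : AnalyticAt ℂ (localLog pc ϖ) 0 :=
  analyticAt_const.add (((hasFPowerSeriesAt_powerSum hx₀ hp).analyticAt.div analyticAt_const
    hp0).clog (powerSum_div_mem_slitPlane hp0))

theorem localLog_zero (hp0 : pc 0 ≠ 0) (ϖ : ℝ) : localLog pc ϖ 0 = phaseLog (pc 0) ϖ := by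
  simp [localLog, powerSum_zero, hp0]

theorem eventually_powerSum_ne_zero (hx₀ : x₀ ≠ 0) (hp : Summable fun n => pc n * x₀ ^ n)
    (hp0 : pc 0 ≠ 0) : ∀ᶠ x in 𝓝 (0 : ℂ), powerSum pc x ≠ 0 :=
  (hasFPowerSeriesAt_powerSum hx₀ hp).analyticAt.continuousAt.eventually_ne
    (by rwa [powerSum_zero])

theorem exp_localLog (hp0 : pc 0 ≠ 0) (hϖ : pc 0 = (‖pc 0‖ : ℂ) * cexp ((ϖ : ℂ) * I)) {x : ℂ}
    (hx : powerSum pc x ≠ 0) : cexp (localLog pc ϖ x) = powerSum pc x := by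
  rw [localLog, Complex.exp_add, exp_phaseLog hp0 hϖ, Complex.exp_log (div_ne_zero hx hp0),
    mul_div_cancel₀ _ hp0]

theorem phasePow_eq (hp0 : pc 0 ≠ 0) {x : ℂ} (hx : powerSum pc x ≠ 0) (e : ℂ) :
    phasePow pc ϖ e x = cexp (e * localLog pc ϖ x) := by
  rw [phasePow, polarPow, cpow_def_of_ne_zero (div_ne_zero hx hp0), ← Complex.exp_add, localLog,
    phaseLog]
  ring_nf

theorem eventually_deriv_powerSum (hx₀ : x₀ ≠ 0) (hp : Summable fun n => pc n * x₀ ^ n)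
    (hp0 : pc 0 ≠ 0) (hϖ : pc 0 = (‖pc 0‖ : ℂ) * cexp ((ϖ : ℂ) * I)) :
    ∀ᶠ x in 𝓝 (0 : ℂ), deriv (powerSum pc) x = powerSum pc x * deriv (localLog pc ϖ) x := by
  filter_upwards [(eventually_powerSum_ne_zero hx₀ hp hp0).eventually_nhds,
    (analyticAt_localLog hx₀ hp hp0 ϖ).eventually_analyticAt] with x hx hL
  have h : powerSum pc =ᶠ[𝓝 x] fun x => cexp (localLog pc ϖ x) := by
    filter_upwards [hx] with y hy using (exp_localLog hp0 hϖ hy).symm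
  rw [h.deriv_eq, h.eq_of_nhds, deriv_cexp hL.differentiableAt]

theorem analyticAt_localRoot (hx₀ : x₀ ≠ 0) (hp : Summable fun n => pc n * x₀ ^ n)
    (hp0 : pc 0 ≠ 0) (ϖ μ : ℝ) : AnalyticAt ℂ (localRoot pc ϖ μ) 0 :=
  ((analyticAt_localLog hx₀ hp hp0 ϖ).mul analyticAt_const).cexp

theorem localRoot_ne_zero (pc : ℕ → ℂ) (ϖ μ : ℝ) (x : ℂ) : localRoot pc ϖ μ x ≠ 0 :=
  Complex.exp_ne_zero _

theorem eventually_deriv_localRoot (hx₀ : x₀ ≠ 0) (hp : Summable fun n => pc n * x₀ ^ n)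
    (hp0 : pc 0 ≠ 0) (ϖ μ : ℝ) : ∀ᶠ x in 𝓝 (0 : ℂ),
      deriv (localRoot pc ϖ μ) x = localRoot pc ϖ μ x * (deriv (localLog pc ϖ) x / μ) := by
  filter_upwards [(analyticAt_localLog hx₀ hp hp0 ϖ).eventually_analyticAt] with x hL
  unfold localRoot
  rw [deriv_cexp (hL.differentiableAt.div_const _), deriv_div_const]

theorem analyticAt_seriesB (hx₀ : x₀ ≠ 0) (hp : Summable fun n => pc n * x₀ ^ n)
    (hq : Summable fun n => qc n * x₀ ^ n) (hp0 : pc 0 ≠ 0) (hμ : μ ≠ 0) (lam : ℂ) (ϖ : ℝ) :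
    AnalyticAt ℂ (seriesB pc qc μ lam ϖ) 0 := by
  have hL := analyticAt_localLog hx₀ hp hp0 ϖ
  refine ((hasFPowerSeriesAt_powerSum hx₀ hq).analyticAt.mul (analyticAt_const.mul hL).cexp).div
    (analyticAt_const.add (analyticAt_id.mul hL.deriv)) ?_
  simpa using hμ

theorem analyticAt_seriesC (hx₀ : x₀ ≠ 0) (hp : Summable fun n => pc n * x₀ ^ n)
    (hr : Summable fun n => rc n * x₀ ^ n) (hp0 : pc 0 ≠ 0) (μ ν : ℝ) (ϖ : ℝ) :
    AnalyticAt ℂ (seriesC pc rc μ ν ϖ) 0 :=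
  (hasFPowerSeriesAt_powerSum hx₀ hr).analyticAt.mul
    (analyticAt_const.mul (analyticAt_localLog hx₀ hp hp0 ϖ)).cexp

theorem eventually_denominator_ne_zero (hx₀ : x₀ ≠ 0) (hp : Summable fun n => pc n * x₀ ^ n)
    (hp0 : pc 0 ≠ 0) (hμ : μ ≠ 0) (ϖ : ℝ) :
    ∀ᶠ x in 𝓝 (0 : ℂ), (μ : ℂ) + x * deriv (localLog pc ϖ) x ≠ 0 := by
  have h : AnalyticAt ℂ (fun x => (μ : ℂ) + x * deriv (localLog pc ϖ) x) 0 :=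
    analyticAt_const.add (analyticAt_id.mul (analyticAt_localLog hx₀ hp hp0 ϖ).deriv)
  refine h.continuousAt.eventually_ne ?_
  simpa using hμ

theorem mul_localRoot_pow (pc : ℕ → ℂ) (ϖ μ : ℝ) (x : ℂ) (n : ℕ) :
    (x * localRoot pc ϖ μ x) ^ n = x ^ n * cexp (n * (localLog pc ϖ x / μ)) := by
  rw [mul_pow, localRoot, ← Complex.exp_nat_mul]

/-- With L = `localLog` and h = x e^(L/μ) one has h' = e^(L/μ) (μ + x L')/μ. The denominator of
`seriesB` cancels this Jacobian, and the remaining 1/μ is the factor in front of the residue. -/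
theorem coeffB_eq (hx₀ : x₀ ≠ 0) (hp : Summable fun n => pc n * x₀ ^ n)
    (hq : Summable fun n => qc n * x₀ ^ n) (hp0 : pc 0 ≠ 0) (hμ : μ ≠ 0) (n : ℕ) :
    coeffB pc qc μ lam ϖ n = quotSeq (localRoot pc ϖ μ) (seriesB pc qc μ lam ϖ) n 0 := by
  have hμ' : (μ : ℂ) ≠ 0 := by exact_mod_cast hμ
  rw [coeffB, residue_eq_of_eventuallyEq (μ := (μ : ℂ)) (n := n)
    (analyticAt_localRoot hx₀ hp hp0 ϖ μ) (localRoot_ne_zero _ _ _ _)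
    (analyticAt_seriesB hx₀ hp hq hp0 hμ lam ϖ), ← mul_assoc, one_div_mul_cancel hμ', one_mul]
  filter_upwards [nhdsWithin_le_nhds (eventually_powerSum_ne_zero hx₀ hp hp0),
    nhdsWithin_le_nhds (eventually_deriv_localRoot hx₀ hp hp0 ϖ μ),
    nhdsWithin_le_nhds (eventually_denominator_ne_zero hx₀ hp hp0 hμ ϖ), self_mem_nhdsWithin]
    with x hg hk hd hx
  have hx' : x ≠ 0 := hx
  rw [phasePow_eq hp0 hg, hk, mul_localRoot_pow, seriesB, localRoot]
  have e1 : cexp (((n : ℂ) + lam) / μ * localLog pc ϖ x)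
      = cexp (n * (localLog pc ϖ x / μ)) * cexp (lam / μ * localLog pc ϖ x) := by
    rw [← Complex.exp_add]; ring_nf
  have e2 : cexp (((n + 1 : ℕ) : ℂ) * (localLog pc ϖ x / μ))
      = cexp (n * (localLog pc ϖ x / μ)) * cexp (localLog pc ϖ x / μ) := by
    rw [← Complex.exp_add]; push_cast; ring_nf
  rw [e1, e2, neg_mul, Complex.exp_neg]
  have h1 := Complex.exp_ne_zero (n * (localLog pc ϖ x / μ))
  have h2 := Complex.exp_ne_zero (localLog pc ϖ x / μ)
  have h3 := Complex.exp_ne_zero (lam / μ * localLog pc ϖ x)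
  generalize cexp (n * (localLog pc ϖ x / μ)) = E1 at *
  generalize cexp (localLog pc ϖ x / μ) = E2 at *
  generalize cexp (lam / μ * localLog pc ϖ x) = E3 at *
  generalize deriv (localLog pc ϖ) x = D at *
  field_simp

/-- The series of p' equals (μ + x L') times that of p - p(a), with L = `localLog`. Its first factor
comes from h', and its second cancels the extra 1 in the exponent (n + ν)/μ + 1. -/
theorem coeffC_eq (hx₀ : x₀ ≠ 0) (hp : Summable fun n => pc n * x₀ ^ n)
    (hr : Summable fun n => rc n * x₀ ^ n) (hp0 : pc 0 ≠ 0)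
    (hϖ : pc 0 = (‖pc 0‖ : ℂ) * cexp ((ϖ : ℂ) * I)) (hμ : μ ≠ 0) (n : ℕ) :
    coeffC pc rc μ ν ϖ n = quotSeq (localRoot pc ϖ μ) (seriesC pc rc μ ν ϖ) n 0 := by
  have hμ' : (μ : ℂ) ≠ 0 := by exact_mod_cast hμ
  rw [coeffC, residue_eq_of_eventuallyEq (μ := (μ : ℂ)) (n := n)
    (analyticAt_localRoot hx₀ hp hp0 ϖ μ) (localRoot_ne_zero _ _ _ _)
    (analyticAt_seriesC hx₀ hp hr hp0 μ ν ϖ), ← mul_assoc, one_div_mul_cancel hμ', one_mul]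
  filter_upwards [nhdsWithin_le_nhds (eventually_powerSum_ne_zero hx₀ hp hp0),
    nhdsWithin_le_nhds (eventually_deriv_localRoot hx₀ hp hp0 ϖ μ),
    nhdsWithin_le_nhds (eventually_powerSum_deriv hx₀ hp μ),
    nhdsWithin_le_nhds (eventually_deriv_powerSum hx₀ hp hp0 hϖ), self_mem_nhdsWithin]
    with x hg hk hs hd hx
  have hx' : x ≠ 0 := hx
  rw [phasePow_eq hp0 hg, hk, mul_localRoot_pow, seriesC, localRoot, hs, hd]
  have e1 : cexp ((((n : ℂ) + ν) / μ + 1) * localLog pc ϖ x)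
      = cexp (n * (localLog pc ϖ x / μ)) * cexp (ν / μ * localLog pc ϖ x) * powerSum pc x := by
    rw [← exp_localLog hp0 hϖ hg, ← Complex.exp_add, ← Complex.exp_add]; ring_nf
  have e2 : cexp (((n + 1 : ℕ) : ℂ) * (localLog pc ϖ x / μ))
      = cexp (n * (localLog pc ϖ x / μ)) * cexp (localLog pc ϖ x / μ) := by
    rw [← Complex.exp_add]; push_cast; ring_nf
  rw [e1, e2, neg_mul, Complex.exp_neg]
  have h1 := Complex.exp_ne_zero (n * (localLog pc ϖ x / μ))
  have h2 := Complex.exp_ne_zero (localLog pc ϖ x / μ)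
  have h3 := Complex.exp_ne_zero (ν / μ * localLog pc ϖ x)
  generalize cexp (n * (localLog pc ϖ x / μ)) = E1 at *
  generalize cexp (localLog pc ϖ x / μ) = E2 at *
  generalize cexp (ν / μ * localLog pc ϖ x) = E3 at *
  generalize deriv (localLog pc ϖ) x = D at *
  field_simp

theorem seriesB_zero (hp0 : pc 0 ≠ 0) :
    seriesB pc qc μ lam ϖ 0 = qc 0 * cexp (-(lam / μ) * phaseLog (pc 0) ϖ) / μ := by
  simp [seriesB, localLog_zero hp0, powerSum_zero]

theorem seriesC_zero (hp0 : pc 0 ≠ 0) :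
    seriesC pc rc μ ν ϖ 0 = rc 0 * cexp (-(ν / μ) * phaseLog (pc 0) ϖ) := by
  simp [seriesC, localLog_zero hp0, powerSum_zero]

theorem deriv_localLog_zero (hx₀ : x₀ ≠ 0) (hp : Summable fun n => pc n * x₀ ^ n)
    (hp0 : pc 0 ≠ 0) (hϖ : pc 0 = (‖pc 0‖ : ℂ) * cexp ((ϖ : ℂ) * I)) :
    deriv (localLog pc ϖ) 0 = pc 1 / pc 0 := by
  have h := (eventually_deriv_powerSum hx₀ hp hp0 hϖ).self_of_nhds
  rw [deriv_powerSum_zero hx₀ hp, powerSum_zero] at h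
  rw [h, mul_div_cancel_left₀ _ hp0]

theorem deriv_seriesB_zero (hx₀ : x₀ ≠ 0) (hp : Summable fun n => pc n * x₀ ^ n)
    (hq : Summable fun n => qc n * x₀ ^ n) (hp0 : pc 0 ≠ 0)
    (hϖ : pc 0 = (‖pc 0‖ : ℂ) * cexp ((ϖ : ℂ) * I)) (hμ : μ ≠ 0) :
    deriv (seriesB pc qc μ lam ϖ) 0 = (qc 1 / μ - (lam + 1) * pc 1 * qc 0 / ((μ : ℂ) ^ 2 * pc 0))
      * cexp (-(lam / μ) * phaseLog (pc 0) ϖ) := by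
  have hμ' : (μ : ℂ) ≠ 0 := by exact_mod_cast hμ
  have hL := analyticAt_localLog hx₀ hp hp0 ϖ
  have hL0 := hL.differentiableAt.hasDerivAt
  have hq0 := (hasFPowerSeriesAt_powerSum hx₀ hq).analyticAt.differentiableAt.hasDerivAt
  rw [deriv_powerSum_zero hx₀ hq] at hq0
  have hden := ((hasDerivAt_id (0 : ℂ)).fun_mul hL.deriv.differentiableAt.hasDerivAt).const_add
    (μ : ℂ)
  have h := (hq0.fun_mul ((hL0.const_mul (-(lam / μ))).cexp)).fun_div hden (by simpa using hμ')
  unfold seriesB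
  refine h.deriv.trans ?_
  simp only [id, zero_mul, add_zero, one_mul, powerSum_zero, localLog_zero hp0,
    deriv_localLog_zero hx₀ hp hp0 hϖ]
  field_simp
  ring

theorem deriv_seriesC_zero (hx₀ : x₀ ≠ 0) (hp : Summable fun n => pc n * x₀ ^ n)
    (hr : Summable fun n => rc n * x₀ ^ n) (hp0 : pc 0 ≠ 0)
    (hϖ : pc 0 = (‖pc 0‖ : ℂ) * cexp ((ϖ : ℂ) * I)) :
    deriv (seriesC pc rc μ ν ϖ) 0 = (rc 1 - ν * pc 1 * rc 0 / (μ * pc 0))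
      * cexp (-(ν / μ) * phaseLog (pc 0) ϖ) := by
  have hL0 := (analyticAt_localLog hx₀ hp hp0 ϖ).differentiableAt.hasDerivAt
  have hr0 := (hasFPowerSeriesAt_powerSum hx₀ hr).analyticAt.differentiableAt.hasDerivAt
  rw [deriv_powerSum_zero hx₀ hr] at hr0
  have h := hr0.fun_mul ((hL0.const_mul (-(ν / μ) : ℂ)).cexp)
  unfold seriesC
  refine h.deriv.trans ?_
  simp only [powerSum_zero, localLog_zero hp0, deriv_localLog_zero hx₀ hp hp0 hϖ]
  field_simp
  ring

theorem ordBell_zero_right (c : ℕ → ℂ) (n : ℕ) : ordBell c n 0 = if n = 0 then 1 else 0 := by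
  rw [ordBell, pow_zero, PowerSeries.coeff_one]

theorem ordBell_one_one (c : ℕ → ℂ) : ordBell c 1 1 = c 1 := by
  simp [ordBell]

theorem polarPow_eq (c : ℂ) (ϖ : ℝ) (e : ℂ) : polarPow ‖c‖ ϖ e = cexp (e * phaseLog c ϖ) := rfl

theorem coeffF_zero_zero (hx₀ : x₀ ≠ 0) (hp : Summable fun n => pc n * x₀ ^ n)
    (hq : Summable fun n => qc n * x₀ ^ n) (hp0 : pc 0 ≠ 0) (hμ : μ ≠ 0) :
    coeffF pc qc rc μ ν lam ϖ 0 0 = qc 0 / (μ * polarPow ‖pc 0‖ ϖ (lam / μ)) := by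
  simp only [coeffF, Finset.Icc_self, Finset.sum_singleton, ordBell_zero_right, if_true,
    coeffB_eq hx₀ hp hq hp0 hμ, Nat.sub_zero, quotSeq, seriesB_zero hp0, polarPow_eq, neg_mul,
    Complex.exp_neg]
  simp
  field_simp

theorem coeffF_one_zero (hx₀ : x₀ ≠ 0) (hp : Summable fun n => pc n * x₀ ^ n)
    (hq : Summable fun n => qc n * x₀ ^ n) (hp0 : pc 0 ≠ 0)
    (hϖ : pc 0 = (‖pc 0‖ : ℂ) * cexp ((ϖ : ℂ) * I)) (hμ : μ ≠ 0) :
    coeffF pc qc rc μ ν lam ϖ 1 0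
      = (qc 1 / μ - (lam + 1) * pc 1 * qc 0 / ((μ : ℂ) ^ 2 * pc 0))
          * (1 / polarPow ‖pc 0‖ ϖ ((1 + lam) / μ)) := by
  -- For m = 0 the Bell polynomials are the coefficients of the series 1, so only j = 0 survives.
  rw [coeffF, Finset.sum_eq_single_of_mem 0 (by simp)
    (fun j _ hj => by rw [ordBell_zero_right, if_neg hj, mul_zero]), ordBell_zero_right, if_pos rfl,
    coeffB_eq hx₀ hp hq hp0 hμ, Nat.sub_zero, quotSeq_one_apply_zero,
    deriv_seriesB_zero hx₀ hp hq hp0 hϖ hμ, localRoot, localLog_zero hp0, polarPow_eq,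
    show (1 + lam) / μ * phaseLog (pc 0) ϖ = lam / μ * phaseLog (pc 0) ϖ + phaseLog (pc 0) ϖ / μ by
      ring, Complex.exp_add, neg_mul, Complex.exp_neg]
  simp
  ring

theorem coeffF_one_one (hx₀ : x₀ ≠ 0) (hp : Summable fun n => pc n * x₀ ^ n)
    (hq : Summable fun n => qc n * x₀ ^ n) (hr : Summable fun n => rc n * x₀ ^ n) (hp0 : pc 0 ≠ 0)
    (hϖ : pc 0 = (‖pc 0‖ : ℂ) * cexp ((ϖ : ℂ) * I)) (hμ : μ ≠ 0) :
    coeffF pc qc rc μ ν lam ϖ 1 1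
      = (rc 1 / μ - ν * pc 1 * rc 0 / ((μ : ℂ) ^ 2 * pc 0))
          * (qc 0 / polarPow ‖pc 0‖ ϖ ((1 + lam + ν) / μ)) := by
  have hμ' : (μ : ℂ) ≠ 0 := by exact_mod_cast hμ
  rw [coeffF, Finset.Icc_self, Finset.sum_singleton, ordBell_one_one,
    coeffB_eq hx₀ hp hq hp0 hμ, Nat.sub_self, coeffC_eq hx₀ hp hr hp0 hϖ hμ,
    quotSeq_one_apply_zero, quotSeq,
    deriv_seriesC_zero hx₀ hp hr hp0 hϖ, seriesB_zero hp0, localRoot, localLog_zero hp0,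
    polarPow_eq,
    show (1 + lam + ν) / μ * phaseLog (pc 0) ϖ = lam / μ * phaseLog (pc 0) ϖ
      + ν / μ * phaseLog (pc 0) ϖ + phaseLog (pc 0) ϖ / μ by ring,
    Complex.exp_add, Complex.exp_add, neg_mul, neg_mul, Complex.exp_neg, Complex.exp_neg]
  have h1 := Complex.exp_ne_zero (lam / μ * phaseLog (pc 0) ϖ)
  have h2 := Complex.exp_ne_zero (ν / μ * phaseLog (pc 0) ϖ)
  have h3 := Complex.exp_ne_zero (phaseLog (pc 0) ϖ / μ)
  generalize cexp (lam / μ * phaseLog (pc 0) ϖ) = E1 at *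
  generalize cexp (ν / μ * phaseLog (pc 0) ϖ) = E2 at *
  generalize cexp (phaseLog (pc 0) ϖ / μ) = E3 at *
  simp
  field_simp

end

/-! ### Asymptotic expansions in powers of y, and exp(A R) Q uniformly in A -/

/-- `f` has the asymptotic expansion `∑ j, coeff j a * y ^ j` along the filter `l`. -/
def HasTrunc {ι : Type*} (l : Filter ι) (y f : ι → ℂ) (a : PowerSeries ℂ) : Prop :=
  ∀ N : ℕ, (fun s => f s - ∑ j ∈ Finset.range N, PowerSeries.coeff j a * y s ^ j)
    =O[l] fun s => y s ^ N

namespace HasTrunc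

open Asymptotics

variable {ι : Type*} {l : Filter ι} {y f g : ι → ℂ} {a b : PowerSeries ℂ}

theorem isBigO_one (hf : HasTrunc l y f a) : f =O[l] fun _ => (1 : ℂ) := by
  simpa using hf 0

theorem one : HasTrunc l y (fun _ => 1) 1 := by
  intro N
  rcases N with _ | N
  · simpa using isBigO_refl (fun _ : ι => (1 : ℂ)) l
  · rw [show (fun s => (1 : ℂ) - ∑ j ∈ Finset.range (N + 1),
      PowerSeries.coeff j (1 : PowerSeries ℂ) * y s ^ j) = fun _ => 0 by
        ext s
        simp [PowerSeries.coeff_one]]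
    exact isBigO_zero _ _

theorem sum_eq_eval_trunc (a : PowerSeries ℂ) (N : ℕ) (x : ℂ) :
    ∑ j ∈ Finset.range N, PowerSeries.coeff j a * x ^ j = (PowerSeries.trunc N a).eval x := by
  rw [Polynomial.eval, PowerSeries.eval₂_trunc_eq_sum_range]
  simp

theorem mul (hy : Tendsto y l (𝓝 0)) (hf : HasTrunc l y f a) (hg : HasTrunc l y g b) :
    HasTrunc l y (fun s => f s * g s) (a * b) := by
  intro N
  simp only [sum_eq_eval_trunc]
  set Pa := PowerSeries.trunc N a
  set Pb := PowerSeries.trunc N b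
  set Pc := PowerSeries.trunc N (a * b)
  -- The product of the truncations agrees with the truncated product below degree N, so they differ
  -- by X^N times a polynomial, which stays bounded as y → 0.
  obtain ⟨D, hD⟩ : Polynomial.X ^ N ∣ Pa * Pb - Pc := by
    rw [Polynomial.X_pow_dvd_iff]
    intro d hd
    rw [Polynomial.coeff_sub, Polynomial.coeff_mul, PowerSeries.coeff_trunc, if_pos hd,
      PowerSeries.coeff_mul, sub_eq_zero]
    refine Finset.sum_congr rfl fun ij hij => ?_
    have := Finset.HasAntidiagonal.mem_antidiagonal.1 hij
    rw [PowerSeries.coeff_trunc, PowerSeries.coeff_trunc, if_pos (by omega), if_pos (by omega)]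
  have hev : ∀ P : Polynomial ℂ, (fun s => P.eval (y s)) =O[l] fun _ => (1 : ℂ) := fun P =>
    ((P.continuous.tendsto 0).comp hy).isBigO_one ℂ
  have h1 := hf N
  have h2 := hg N
  simp only [sum_eq_eval_trunc] at h1 h2
  have e1 : (fun s => (f s - Pa.eval (y s)) * g s) =O[l] fun s => y s ^ N := by
    simpa using h1.mul hg.isBigO_one
  have e2 : (fun s => Pa.eval (y s) * (g s - Pb.eval (y s))) =O[l] fun s => y s ^ N := by
    simpa using (hev Pa).mul h2
  have e3 : (fun s => (y s) ^ N * D.eval (y s)) =O[l] fun s => y s ^ N := by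
    simpa using (isBigO_refl (fun s => y s ^ N) l).mul (hev D)
  refine ((e1.add e2).add e3).congr_left fun s => ?_
  have h3 : Pa.eval (y s) * Pb.eval (y s) - Pc.eval (y s) = y s ^ N * D.eval (y s) := by
    rw [← Polynomial.eval_mul, ← Polynomial.eval_sub, hD]; simp
  rw [← h3]; ring

theorem pow (hy : Tendsto y l (𝓝 0)) (hf : HasTrunc l y f a) (m : ℕ) :
    HasTrunc l y (fun s => f s ^ m) (a ^ m) := by
  induction m with
  | zero => simpa using one
  | succ m ih => simpa only [pow_succ] using mul hy ih hf

end HasTrunc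

theorem coeff_pow_eq_zero {c : PowerSeries ℂ} (hc : PowerSeries.coeff 0 c = 0) {j m : ℕ}
    (h : j < m) : PowerSeries.coeff j (c ^ m) = 0 :=
  PowerSeries.coeff_of_lt_order j (lt_of_lt_of_le (by exact_mod_cast h)
    (PowerSeries.le_order_pow_of_constantCoeff_eq_zero m (by simpa using hc)))

theorem coeff_pow_mul {b c : PowerSeries ℂ} (hc : PowerSeries.coeff 0 c = 0) (n m : ℕ) :
    PowerSeries.coeff n (c ^ m * b) = ∑ j ∈ Finset.Icc m n,
      PowerSeries.coeff (n - j) b * PowerSeries.coeff j (c ^ m) := by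
  rw [PowerSeries.coeff_mul, Finset.Nat.sum_antidiagonal_eq_sum_range_succ
    (fun i j => PowerSeries.coeff i (c ^ m) * PowerSeries.coeff j b)]
  symm
  refine Finset.sum_subset_zero_on_sdiff (fun j hj => ?_) (fun j hj => ?_) fun j _ => mul_comm _ _
  · simp at hj ⊢; omega
  · simp at hj
    rw [coeff_pow_eq_zero hc (by omega), zero_mul]

/-- The coefficient of `A ^ m * x ^ n` in `exp (A * c(x)) * b(x)`. -/
def expCoeff (b c : PowerSeries ℂ) (n m : ℕ) : ℂ :=
  (1 / (m.factorial : ℂ)) * ∑ j ∈ Finset.Icc m n,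
    PowerSeries.coeff (n - j) b * PowerSeries.coeff j (c ^ m)

/-- As `c` has no constant term, c^m starts in degree m, so the triangle m ≤ n may be enlarged to
the full square and summed over m last. -/
theorem sum_expCoeff {b c : PowerSeries ℂ} (hc : PowerSeries.coeff 0 c = 0) (N : ℕ) (x A : ℂ) :
    ∑ n ∈ Finset.range N, x ^ n * ∑ m ∈ Finset.range (n + 1), expCoeff b c n m * A ^ m
      = ∑ m ∈ Finset.range N, A ^ m / m.factorial *
        ∑ n ∈ Finset.range N, PowerSeries.coeff n (c ^ m * b) * x ^ n := by
  simp_rw [Finset.mul_sum]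
  rw [Finset.sum_comm (s := Finset.range N) (t := Finset.range N)]
  refine Finset.sum_congr rfl fun n hn => ?_
  refine Finset.sum_subset_zero_on_sdiff (fun j hj => ?_) (fun m hm => ?_) fun m _ => ?_
  · simp at hj hn ⊢; omega
  · simp at hm
    rw [coeff_pow_mul hc, Finset.Icc_eq_empty (by omega)]
    simp
  · rw [coeff_pow_mul hc, expCoeff]; ring

theorem norm_pow_le_factorial_mul_exp (t : ℝ) (ht : 0 ≤ t) (m : ℕ) :
    t ^ m ≤ m.factorial * Real.exp t := by
  have := Real.pow_div_factorial_le_exp t ht m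
  rwa [div_le_iff₀ (by positivity), mul_comm] at this

/-- Uniformity in `A` is the point, because `A` will be (z(p - p(a)))^κ, which is unbounded. The
error splits into the Taylor remainder of exp at AR, of order (AR)^N with R = O(y), and the
truncation errors of R^m Q for m < N. -/
theorem HasTrunc.exists_norm_exp_mul_sub_le {ι : Type*} {l : Filter ι} {y R Q : ι → ℂ}
    {b c : PowerSeries ℂ} (hy : Tendsto y l (𝓝 0)) (hR : HasTrunc l y R c) (hQ : HasTrunc l y Q b)
    (hc : PowerSeries.coeff 0 c = 0) (N : ℕ) :
    ∃ K : ℝ, 0 < K ∧ ∀ᶠ s in l, ∀ A : ℂ,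
      ‖cexp (A * R s) * Q s - ∑ n ∈ Finset.range N, y s ^ n *
        ∑ m ∈ Finset.range (n + 1), expCoeff b c n m * A ^ m‖
        ≤ K * ‖y s‖ ^ N * Real.exp (K * ‖A‖) := by
  have hR1 := hR 1
  simp only [Finset.range_one, Finset.sum_singleton, hc, zero_mul, sub_zero, pow_one] at hR1
  obtain ⟨K₁, hK₁, h₁⟩ := hR1.exists_pos
  obtain ⟨K₂, hK₂, h₂⟩ := hQ.isBigO_one.exists_pos
  have h₃ : ∀ m : ℕ, ∃ K : ℝ, 0 < K ∧ Asymptotics.IsBigOWith K l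
      (fun s => R s ^ m * Q s - ∑ j ∈ Finset.range N, PowerSeries.coeff j (c ^ m * b) * y s ^ j)
      (fun s => y s ^ N) := fun m => (((hR.pow hy m).mul hy hQ) N).exists_pos
  choose K₃ hK₃ h₃ using h₃
  set S : ℝ := ∑ m ∈ Finset.range N, K₃ m
  have hS : 0 ≤ S := Finset.sum_nonneg fun m _ => (hK₃ m).le
  set B : ℝ := K₁ ^ N * N.factorial * K₂ + S
  refine ⟨max B (K₁ + 1), lt_of_lt_of_le (by positivity) (le_max_right _ _), ?_⟩
  have h₃' := (Finset.eventually_all (Finset.range N)).2 fun m _ => (h₃ m).bound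
  filter_upwards [h₁.bound, h₂.bound, h₃',
    hy.norm.eventually_le_const (show ‖(0 : ℂ)‖ < 1 by simp)] with s e₁ e₂ e₃ ey A
  simp only [norm_one, mul_one] at e₂
  rw [sum_expCoeff hc]
  have hx : ∑ m ∈ Finset.range N, A ^ m / m.factorial * (R s ^ m * Q s)
      = (∑ m ∈ Finset.range N, (A * R s) ^ m / m.factorial) * Q s := by
    rw [Finset.sum_mul]
    refine Finset.sum_congr rfl fun m _ => ?_
    rw [mul_pow]; ring
  have hsplit : cexp (A * R s) * Q s - ∑ m ∈ Finset.range N, A ^ m / m.factorial *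
      ∑ n ∈ Finset.range N, PowerSeries.coeff n (c ^ m * b) * y s ^ n
      = (cexp (A * R s) - ∑ m ∈ Finset.range N, (A * R s) ^ m / m.factorial) * Q s
        + ∑ m ∈ Finset.range N, A ^ m / m.factorial * (R s ^ m * Q s
          - ∑ n ∈ Finset.range N, PowerSeries.coeff n (c ^ m * b) * y s ^ n) := by
    simp_rw [mul_sub]
    rw [Finset.sum_sub_distrib, hx]; ring
  rw [hsplit]
  have b1 : ‖(cexp (A * R s) - ∑ m ∈ Finset.range N, (A * R s) ^ m / m.factorial) * Q s‖
      ≤ K₁ ^ N * N.factorial * K₂ * ‖y s‖ ^ N * Real.exp ((K₁ + 1) * ‖A‖) := by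
    rw [norm_mul]
    have hAR : ‖A * R s‖ ≤ K₁ * ‖A‖ := by
      rw [norm_mul]
      nlinarith [norm_nonneg A, norm_nonneg (y s), mul_le_mul_of_nonneg_left ey hK₁.le]
    -- The factor |A|^N is traded for N! e^|A|; this is the 1 in the exponent K₁ + 1.
    have hAR' : ‖A * R s‖ ^ N ≤ K₁ ^ N * ‖y s‖ ^ N * (N.factorial * Real.exp ‖A‖) := by
      calc ‖A * R s‖ ^ N ≤ (‖A‖ * (K₁ * ‖y s‖)) ^ N := by
            rw [norm_mul]; gcongr
        _ = K₁ ^ N * ‖y s‖ ^ N * ‖A‖ ^ N := by rw [mul_pow, mul_pow]; ring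
        _ ≤ _ := by gcongr; exact norm_pow_le_factorial_mul_exp _ (norm_nonneg _) _
    calc _ ≤ (‖A * R s‖ ^ N * Real.exp ‖A * R s‖) * K₂ := by
          gcongr
          exact norm_exp_sub_sum_le_norm_mul_exp _ _
      _ ≤ (K₁ ^ N * ‖y s‖ ^ N * (N.factorial * Real.exp ‖A‖) * Real.exp (K₁ * ‖A‖)) * K₂ := by
          gcongr
      _ = K₁ ^ N * N.factorial * K₂ * ‖y s‖ ^ N * (Real.exp (K₁ * ‖A‖) * Real.exp ‖A‖) := by ring
      _ = _ := by rw [← Real.exp_add]; ring_nf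
  have b2 : ‖∑ m ∈ Finset.range N, A ^ m / m.factorial * (R s ^ m * Q s
      - ∑ n ∈ Finset.range N, PowerSeries.coeff n (c ^ m * b) * y s ^ n)‖
      ≤ S * ‖y s‖ ^ N * Real.exp ((K₁ + 1) * ‖A‖) := by
    refine (norm_sum_le _ _).trans ?_
    rw [Finset.sum_mul, Finset.sum_mul]
    refine Finset.sum_le_sum fun m hm => ?_
    rw [norm_mul, norm_div, norm_pow, norm_natCast]
    have h4 := e₃ m hm
    rw [norm_pow] at h4
    have h5 : ‖A‖ ^ m / m.factorial ≤ Real.exp ((K₁ + 1) * ‖A‖) :=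
      (Real.pow_div_factorial_le_exp _ (norm_nonneg _) m).trans
        (Real.exp_le_exp.2 (by nlinarith [norm_nonneg A]))
    calc _ ≤ Real.exp ((K₁ + 1) * ‖A‖) * (K₃ m * ‖y s‖ ^ N) := by gcongr
      _ = _ := by ring
  calc _ ≤ _ := (norm_add_le _ _).trans (add_le_add b1 b2)
    _ = B * ‖y s‖ ^ N * Real.exp ((K₁ + 1) * ‖A‖) := by ring
    _ ≤ _ := by
      gcongr
      · exact le_max_left _ _
      · exact le_max_right _ _

/-! ### The integral near the endpoint, in the logarithmic variable -/

/-- The logarithm of `ρ * exp (i θ)` determined by the phase `θ`. -/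
def polarLog (ρ θ : ℝ) : ℂ := (Real.log ρ : ℝ) + (θ : ℝ) * I

theorem polarPow_eq_exp (ρ θ : ℝ) (c : ℂ) : polarPow ρ θ c = cexp (c * polarLog ρ θ) := rfl

theorem exp_polarLog {ρ : ℝ} (hρ : 0 < ρ) (θ : ℝ) :
    cexp (polarLog ρ θ) = ρ * cexp (θ * I) := by
  rw [polarLog, Complex.exp_add, ← ofReal_exp, Real.exp_log hρ]

theorem norm_exp_polarLog_add {ρ : ℝ} (hρ : 0 < ρ) (θ : ℝ) (V : ℂ) :
    ‖cexp (polarLog ρ θ + V)‖ = ρ * ‖cexp V‖ := by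
  rw [Complex.exp_add, norm_mul, exp_polarLog hρ, norm_mul, norm_exp_ofReal_mul_I, mul_one,
    norm_real, Real.norm_of_nonneg hρ.le]

theorem integrableOn_rpow_mul_exp_neg {μ e b : ℝ} (hμ : 0 < μ) (he : 0 < e) (hb : 0 < b) :
    IntegrableOn (fun s : ℝ => s ^ (e - 1) * Real.exp (-b * s ^ μ)) (Ioi 0) ∧
      ∫ s in Ioi (0 : ℝ), s ^ (e - 1) * Real.exp (-b * s ^ μ)
        = b ^ (-e / μ) * (1 / μ * Real.Gamma (e / μ)) := by
  have h := _root_.integral_rpow_mul_exp_neg_mul_rpow hμ (show -1 < e - 1 by linarith) hb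
  rw [show e - 1 + 1 = e by ring] at h
  refine ⟨?_, by rw [h]; ring⟩
  -- A non-integrable function would have integral 0, whereas the closed form is positive.
  by_contra hni
  rw [integral_undef hni] at h
  have : 0 < b ^ (-e / μ) * (1 / μ) * Real.Gamma (e / μ) := by
    have := Real.Gamma_pos_of_pos (show 0 < e / μ by positivity)
    positivity
  linarith

section

variable {μ κ d m₂ m₃ θ c₀ ρ : ℝ} {Λ Λ' : ℝ → ℂ}

/-- The integrand is the derivative of G(log z + Λ). The lower limit contributes nothing, since Re Λ
→ -∞ as s → 0 and `G` decays there. -/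
theorem integrableOn_and_integral_logIntegrand (hμ : 0 < μ) (hκ0 : 0 ≤ κ) (hκ1 : κ < 1)
    (hd0 : 0 ≤ d) (hd : d < Real.pi / 2) {β : ℂ} (hβ : 0 < β.re) (x : ℂ) (hρ : 0 < ρ) (hc₀ : 0 < c₀)
    (hΛ : ∀ s ∈ Ioc 0 c₀, HasDerivAt Λ (Λ' s) s) (hΛc : ∀ s ∈ Ioc 0 c₀, ContinuousAt Λ' s)
    (hup : ∀ s ∈ Ioc 0 c₀, ‖cexp (Λ s)‖ ≤ m₂ * s ^ μ) (hΛ' : ∀ s ∈ Ioc 0 c₀, ‖Λ' s‖ ≤ m₃ / s)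
    (him : ∀ s ∈ Ioc 0 c₀, |(Λ s).im + θ| ≤ d)
    {G : ℂ → ℂ} (hG : ∀ W, HasDerivAt G (logIntegrand κ β x W) W)
    (hG0 : ∃ C : ℝ, 0 < C ∧ ∀ W : ℂ, |W.im| ≤ d → ‖G W‖ ≤ C * Real.exp (β.re * W.re)) :
    IntegrableOn (fun s => logIntegrand κ β x (polarLog ρ θ + Λ s) * Λ' s) (Ioo 0 c₀) ∧
      ∫ s in Ioo 0 c₀, logIntegrand κ β x (polarLog ρ θ + Λ s) * Λ' s
        = G (polarLog ρ θ + Λ c₀) := by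
  have him' : ∀ s ∈ Ioc 0 c₀, |(polarLog ρ θ + Λ s).im| ≤ d := by
    intro s hs
    have : (polarLog ρ θ + Λ s).im = (Λ s).im + θ := by simp [polarLog, add_comm]
    rw [this]; exact him s hs
  have hexp : ∀ s ∈ Ioc 0 c₀, Real.exp (β.re * (polarLog ρ θ + Λ s).re)
      ≤ (ρ * m₂) ^ β.re * s ^ (μ * β.re) := by
    intro s hs
    have h1 : Real.exp (β.re * (polarLog ρ θ + Λ s).re)
        = ‖cexp (polarLog ρ θ + Λ s)‖ ^ β.re := by
      rw [norm_exp, ← Real.exp_mul, mul_comm]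
    have h2 : 0 ≤ m₂ := by
      have := (norm_nonneg _).trans (hup s hs)
      exact nonneg_of_mul_nonneg_left this (Real.rpow_pos_of_pos hs.1 μ)
    rw [h1, norm_exp_polarLog_add hρ, Real.rpow_mul hs.1.le,
      ← Real.mul_rpow (by positivity) (Real.rpow_nonneg hs.1.le _)]
    refine Real.rpow_le_rpow (by positivity) ?_ hβ.le
    calc ρ * ‖cexp (Λ s)‖ ≤ ρ * (m₂ * s ^ μ) := by gcongr; exact hup s hs
      _ = _ := by ring
  have hcont : ∀ s ∈ Ioc 0 c₀,
      ContinuousAt (fun s => logIntegrand κ β x (polarLog ρ θ + Λ s) * Λ' s) s := by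
    intro s hs
    have := (differentiable_logIntegrand κ β x).continuous
    exact (this.continuousAt.comp (continuousAt_const.add (hΛ s hs).continuousAt)).mul (hΛc s hs)
  have hint : IntegrableOn (fun s => logIntegrand κ β x (polarLog ρ θ + Λ s) * Λ' s)
      (Ioc 0 c₀) := by
    obtain ⟨C, hC, h⟩ := exists_norm_logIntegrand_le hκ0 hκ1 hd0 hd β x le_rfl
    have hi : IntegrableOn (fun s : ℝ => C * ((ρ * m₂) ^ β.re) * m₃ * s ^ (μ * β.re - 1))
        (Ioc 0 c₀) := by
      have hp : 0 < μ * β.re := mul_pos hμ hβ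
      exact ((intervalIntegral.intervalIntegrable_rpow' (a := 0) (b := c₀) (r := μ * β.re - 1)
        (by linarith)).1).const_mul _
    refine Integrable.mono' hi ?_ ?_
    · exact ContinuousOn.aestronglyMeasurable (fun s hs => (hcont s hs).continuousWithinAt)
        measurableSet_Ioc
    · refine (ae_restrict_iff' measurableSet_Ioc).2 (ae_of_all _ fun s hs => ?_)
      rw [norm_mul]
      calc _ ≤ (C * ((ρ * m₂) ^ β.re * s ^ (μ * β.re))) * (m₃ / s) := by
            have h1 := (h _ (him' s hs)).trans (mul_le_mul_of_nonneg_left (hexp s hs) hC.le)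
            exact mul_le_mul h1 (hΛ' s hs) (norm_nonneg _) ((norm_nonneg _).trans h1)
        _ = _ := by
            rw [Real.rpow_sub_one hs.1.ne']; ring
  refine ⟨hint.mono_set Ioo_subset_Ioc_self, ?_⟩
  rw [← integral_Ioc_eq_integral_Ioo, ← intervalIntegral.integral_of_le hc₀.le,
    intervalIntegral.integral_eq_sub_of_hasDerivAt_of_tendsto hc₀
      (f := fun s => G (polarLog ρ θ + Λ s)) (fa := 0) (fb := G (polarLog ρ θ + Λ c₀)), sub_zero]
  · intro s hs
    exact (hG _).comp s ((hΛ s (Ioo_subset_Ioc_self hs)).const_add _)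
  · rwa [intervalIntegrable_iff_integrableOn_Ioc_of_le hc₀.le]
  · obtain ⟨C, hC, h⟩ := hG0
    have hlim : Tendsto (fun s : ℝ => C * ((ρ * m₂) ^ β.re * s ^ (μ * β.re))) (𝓝[>] 0) (𝓝 0) := by
      have hp : 0 < μ * β.re := mul_pos hμ hβ
      have := ((Real.continuousAt_rpow_const (0 : ℝ) (μ * β.re) (Or.inr hp.le)).tendsto.mono_left
        (nhdsWithin_le_nhds (s := Ioi 0))).const_mul (C * (ρ * m₂) ^ β.re)
      rw [Real.zero_rpow hp.ne', mul_zero] at this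
      simpa only [mul_assoc] using this
    refine squeeze_zero_norm' ?_ hlim
    filter_upwards [Ioc_mem_nhdsGT hc₀] with s hs
    exact (h _ (him' s hs)).trans (mul_le_mul_of_nonneg_left (hexp s hs) hC.le)
  · have h0 : c₀ ∈ Ioc 0 c₀ := ⟨hc₀, le_rfl⟩
    exact (((hG _).continuousAt.comp (continuousAt_const.add (hΛ c₀ h0).continuousAt)).tendsto).mono_left
      nhdsWithin_le_nhds

end

/-- The local integrand in the logarithmic variable. -/
def localIntegrand (μ κ : ℝ) (lam x : ℂ) (Λ Λ' R Q : ℝ → ℂ) (ρ θ : ℝ) (s : ℝ) : ℂ :=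
  cexp (-cexp (polarLog ρ θ + Λ s) + (x + R s) * cexp (κ * (polarLog ρ θ + Λ s)))
    * (Q s * cexp (lam / μ * Λ s) * Λ' s)

/-- The partial sum of the asymptotic expansion of the integral of `localIntegrand`. -/
def localSum (μ κ : ℝ) (lam x : ℂ) (b c : PowerSeries ℂ) (N : ℕ) (ρ θ : ℝ) : ℂ :=
  ∑ n ∈ Finset.range N, ∑ m ∈ Finset.range (n + 1),
    cexp (-(((n : ℂ) + lam) / μ * polarLog ρ θ)) * expCoeff b c n m *
      faxen κ (((n : ℂ) + lam) / μ + m * κ) x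

/-- Pointwise form of the expansion: with W = log z + Λ, the term y^n A^m y^λ is z^(-(n+λ)/μ) times
e^(βW), β = (n+λ)/μ + mκ. The error has size |y|^(N + Re λ)/s times an exponential in ρ s^μ, because
|y| is at most a multiple of s. -/
theorem exists_local_remainder_bound {μ κ d m₁ m₂ m₃ θ₁ θ₂ : ℝ} {lam : ℂ} {Λ Λ' R Q : ℝ → ℂ}
    {b c : PowerSeries ℂ} (hμ : 0 < μ) (hκ0 : 0 ≤ κ) (hκ1 : κ < 1) (hd : d < Real.pi / 2)
    (hd0 : 0 ≤ d) (hlam : 0 < lam.re) (hθ : θ₁ ≤ θ₂) (x : ℂ) (hm₁ : 0 < m₁) (hm₂ : 0 < m₂)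
    (hlow : ∀ᶠ s in 𝓝[>] (0 : ℝ), m₁ * s ^ μ ≤ ‖cexp (Λ s)‖)
    (hup : ∀ᶠ s in 𝓝[>] (0 : ℝ), ‖cexp (Λ s)‖ ≤ m₂ * s ^ μ)
    (hΛ' : ∀ᶠ s in 𝓝[>] (0 : ℝ), ‖Λ' s‖ ≤ m₃ / s)
    (him : ∀ᶠ s in 𝓝[>] (0 : ℝ), ∀ θ ∈ Icc θ₁ θ₂, |(Λ s).im + θ| ≤ d)
    (hR : HasTrunc (𝓝[>] 0) (fun s => cexp (Λ s / μ)) R c)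
    (hQ : HasTrunc (𝓝[>] 0) (fun s => cexp (Λ s / μ)) Q b)
    (hy : Tendsto (fun s => cexp (Λ s / μ)) (𝓝[>] 0) (𝓝 0))
    (hc : PowerSeries.coeff 0 c = 0) (N : ℕ) :
    ∃ K a : ℝ, 0 < a ∧ ∀ᶠ s in 𝓝[>] (0 : ℝ), ∀ ρ > 0, ∀ θ ∈ Icc θ₁ θ₂,
      ‖localIntegrand μ κ lam x Λ Λ' R Q ρ θ s
        - ∑ n ∈ Finset.range N, ∑ m ∈ Finset.range (n + 1),
          cexp (-(((n : ℂ) + lam) / μ * polarLog ρ θ)) * expCoeff b c n m *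
            (logIntegrand κ (((n : ℂ) + lam) / μ + m * κ) x (polarLog ρ θ + Λ s) * Λ' s)‖
        ≤ K * (s ^ ((N : ℝ) + lam.re - 1) * Real.exp (-(a * ρ) * s ^ μ)) := by
  have hcos : 0 < Real.cos d := Real.cos_pos_of_mem_Ioo ⟨by linarith, hd⟩
  obtain ⟨K₁, hK₁, h₁⟩ := HasTrunc.exists_norm_exp_mul_sub_le hy hR hQ hc N
  obtain ⟨K₂, hK₂, h₂⟩ := exists_norm_exp_neg_exp_le hκ0 hκ1 hcos ‖x‖
  -- Of the available decay (cos d / 2)|e^W|, one half absorbs exp(K₁|A|) and the other half is left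
  -- for integration.
  obtain ⟨K₃, hK₃, h₃⟩ := exists_mul_rpow_le_mul_add hκ0 hκ1 hK₁.le
    (show 0 < Real.cos d / 4 by positivity)
  -- `D` bounds the effect of Im λ in |exp(λΛ/μ)|, as |Im Λ| ≤ d + |θ₁|.
  set D : ℝ := Real.exp (|lam.im| / μ * (d + |θ₁|)) with hD
  refine ⟨K₁ * K₂ * Real.exp K₃ * (m₂ ^ (1 / μ)) ^ ((N : ℝ) + lam.re) * D * m₃,
    Real.cos d / 4 * m₁, by positivity, ?_⟩
  filter_upwards [h₁, hlow, hup, hΛ', him, self_mem_nhdsWithin] with s g₁ glow gup gΛ gim hs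
    ρ hρ θ hθ'
  have hs' : 0 < s := hs
  set W := polarLog ρ θ + Λ s with hW
  set A := cexp (κ * W) with hA
  have hWim : |W.im| ≤ d := by
    have : W.im = (Λ s).im + θ := by simp [hW, polarLog, add_comm]
    rw [this]; exact gim θ hθ'
  have hkey : localIntegrand μ κ lam x Λ Λ' R Q ρ θ s
        - ∑ n ∈ Finset.range N, ∑ m ∈ Finset.range (n + 1),
          cexp (-(((n : ℂ) + lam) / μ * polarLog ρ θ)) * expCoeff b c n m *
            (logIntegrand κ (((n : ℂ) + lam) / μ + m * κ) x W * Λ' s)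
      = cexp (-cexp W + x * A) * (cexp (A * R s) * Q s - ∑ n ∈ Finset.range N,
          cexp (Λ s / μ) ^ n * ∑ m ∈ Finset.range (n + 1), expCoeff b c n m * A ^ m)
          * cexp (lam / μ * Λ s) * Λ' s := by
    rw [localIntegrand, ← hW, ← hA, mul_sub, sub_mul, sub_mul]
    congr 1
    · rw [show -cexp W + (x + R s) * A = (-cexp W + x * A) + A * R s by ring, Complex.exp_add]
      ring
    · simp_rw [Finset.mul_sum, Finset.sum_mul]
      refine Finset.sum_congr rfl fun n _ => Finset.sum_congr rfl fun m _ => ?_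
      rw [logIntegrand, ← hA, hA, ← Complex.exp_nat_mul, ← Complex.exp_nat_mul]
      have e : cexp (-(((n : ℂ) + lam) / μ * polarLog ρ θ)) *
          cexp ((((n : ℂ) + lam) / μ + m * κ) * W)
          = cexp (n * (Λ s / μ)) * cexp (m * (κ * W)) * cexp (lam / μ * Λ s) := by
        rw [← Complex.exp_add, ← Complex.exp_add, ← Complex.exp_add, hW]
        ring_nf
      linear_combination (cexp (-cexp W + x * cexp (κ * W)) * expCoeff b c n m * Λ' s) * e
  rw [hkey, norm_mul, norm_mul, norm_mul]
  set X : ℝ := ‖cexp W‖ with hX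
  have hX0 : 0 < X := by simp [hX]
  have b1 : ‖cexp (-cexp W + x * A)‖ ≤ K₂ * Real.exp (-(Real.cos d / 2 * X)) :=
    h₂ W x le_rfl (cos_mul_norm_exp_le_re hd.le hWim)
  have b2 := g₁ A
  have b3 : K₁ * ‖A‖ ≤ Real.cos d / 4 * X + K₃ := by
    rw [hA, norm_exp_real_mul]; exact h₃ X hX0
  set Y : ℝ := ‖cexp (Λ s / μ)‖ with hY
  have hYeq : Y = ‖cexp (Λ s)‖ ^ (1 / μ) := by
    rw [hY, norm_exp, norm_exp, ← Real.exp_mul, div_ofReal_re]; ring_nf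
  have hYpos : 0 < Y := by simp [hY]
  have hYle : Y ≤ m₂ ^ (1 / μ) * s := by
    rw [hYeq]
    calc _ ≤ (m₂ * s ^ μ) ^ (1 / μ) := by gcongr
      _ = _ := by
        rw [Real.mul_rpow hm₂.le (by positivity), ← Real.rpow_mul hs'.le, mul_one_div_cancel hμ.ne',
          Real.rpow_one]
  have b4 : ‖cexp (lam / μ * Λ s)‖ ≤ Y ^ lam.re * D := by
    rw [hY, norm_exp, norm_exp, ← Real.exp_mul, hD, ← Real.exp_add, Real.exp_le_exp, mul_re,
      div_ofReal_re, div_ofReal_re, div_ofReal_im]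
    have h5 : |(Λ s).im| ≤ d + |θ₁| := by
      have := gim θ₁ ⟨le_rfl, hθ⟩
      calc |(Λ s).im| = |((Λ s).im + θ₁) - θ₁| := by ring_nf
        _ ≤ _ := (abs_sub _ _).trans (by linarith)
    have h6 : -(lam.im / μ * (Λ s).im) ≤ |lam.im| / μ * (d + |θ₁|) := by
      refine (neg_le_abs _).trans ?_
      rw [abs_mul, abs_div, abs_of_pos hμ]
      gcongr
    have h7 : lam.re / μ * (Λ s).re = (Λ s).re / μ * lam.re := by ring
    linarith
  have b5 : X ≥ m₁ * ρ * s ^ μ := by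
    rw [hX, hW, norm_exp_polarLog_add hρ]
    nlinarith
  have b6 : Real.exp (-(Real.cos d / 2 * X)) * Real.exp (K₁ * ‖A‖)
      ≤ Real.exp K₃ * Real.exp (-(Real.cos d / 4 * m₁ * ρ) * s ^ μ) := by
    rw [← Real.exp_add, ← Real.exp_add, Real.exp_le_exp]
    nlinarith
  have b7 : Y ^ N * Y ^ lam.re ≤ (m₂ ^ (1 / μ)) ^ ((N : ℝ) + lam.re) * s ^ ((N : ℝ) + lam.re) := by
    rw [← Real.rpow_natCast, ← Real.rpow_add hYpos, ← Real.mul_rpow (by positivity) hs'.le]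
    exact Real.rpow_le_rpow hYpos.le hYle (by positivity)
  have hm₃ : 0 ≤ m₃ / s := (norm_nonneg _).trans gΛ
  calc _ ≤ (K₂ * Real.exp (-(Real.cos d / 2 * X))) * (K₁ * Y ^ N * Real.exp (K₁ * ‖A‖))
        * (Y ^ lam.re * D) * (m₃ / s) := by gcongr
    _ = K₁ * K₂ * D * (m₃ / s) * (Real.exp (-(Real.cos d / 2 * X)) * Real.exp (K₁ * ‖A‖))
        * (Y ^ N * Y ^ lam.re) := by ring
    _ ≤ K₁ * K₂ * D * (m₃ / s) * (Real.exp K₃ * Real.exp (-(Real.cos d / 4 * m₁ * ρ) * s ^ μ))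
        * ((m₂ ^ (1 / μ)) ^ ((N : ℝ) + lam.re) * s ^ ((N : ℝ) + lam.re)) := by gcongr
    _ = _ := by rw [Real.rpow_sub_one hs'.ne']; ring

/-- Two errors add up: the pointwise remainder, integrated against a Gamma kernel over the whole
half-line, and the gap between the primitives at the endpoint `c₀` and Faxén's integrals. Every
small `c₀` works, so it can later be matched with the tail. -/
theorem local_asymptotics {μ κ d m₁ m₂ m₃ θ₁ θ₂ : ℝ} {lam : ℂ} {Λ Λ' R Q : ℝ → ℂ}
    {b c : PowerSeries ℂ} (hμ : 0 < μ) (hκ0 : 0 ≤ κ) (hκ1 : κ < 1) (hd : d < Real.pi / 2)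
    (hd0 : 0 ≤ d) (hlam : 0 < lam.re) (hθ : θ₁ ≤ θ₂) (x : ℂ) (hm₁ : 0 < m₁) (hm₂ : 0 < m₂)
    (hΛ : ∀ᶠ s in 𝓝[>] (0 : ℝ), HasDerivAt Λ (Λ' s) s)
    (hΛc : ∀ᶠ s in 𝓝[>] (0 : ℝ), ContinuousAt Λ' s)
    (hlow : ∀ᶠ s in 𝓝[>] (0 : ℝ), m₁ * s ^ μ ≤ ‖cexp (Λ s)‖)
    (hup : ∀ᶠ s in 𝓝[>] (0 : ℝ), ‖cexp (Λ s)‖ ≤ m₂ * s ^ μ)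
    (hΛ' : ∀ᶠ s in 𝓝[>] (0 : ℝ), ‖Λ' s‖ ≤ m₃ / s)
    (him : ∀ᶠ s in 𝓝[>] (0 : ℝ), ∀ θ ∈ Icc θ₁ θ₂, |(Λ s).im + θ| ≤ d)
    (hRc : ∀ᶠ s in 𝓝[>] (0 : ℝ), ContinuousAt R s)
    (hQc : ∀ᶠ s in 𝓝[>] (0 : ℝ), ContinuousAt Q s)
    (hR : HasTrunc (𝓝[>] 0) (fun s => cexp (Λ s / μ)) R c)
    (hQ : HasTrunc (𝓝[>] 0) (fun s => cexp (Λ s / μ)) Q b)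
    (hy : Tendsto (fun s => cexp (Λ s / μ)) (𝓝[>] 0) (𝓝 0))
    (hc : PowerSeries.coeff 0 c = 0) (N : ℕ) :
    ∀ᶠ c₀ in 𝓝[>] (0 : ℝ), ∃ C : ℝ, ∀ ρ ≥ 1, ∀ θ ∈ Icc θ₁ θ₂,
      IntegrableOn (localIntegrand μ κ lam x Λ Λ' R Q ρ θ) (Ioo 0 c₀) ∧
      ‖(∫ s in Ioo 0 c₀, localIntegrand μ κ lam x Λ Λ' R Q ρ θ s)
        - localSum μ κ lam x b c N ρ θ‖ ≤ C * ρ ^ (-(((N : ℝ) + lam.re) / μ)) := by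
  obtain ⟨K, a, ha, hrem⟩ := exists_local_remainder_bound hμ hκ0 hκ1 hd hd0 hlam hθ x hm₁ hm₂
    hlow hup hΛ' him hR hQ hy hc N
  have hall := hΛ.and (hΛc.and (hup.and (hΛ'.and (him.and (hRc.and (hQc.and hrem))))))
  rw [eventually_nhdsWithin_iff] at hall
  obtain ⟨c₁, hc₁, hball⟩ := Metric.eventually_nhds_iff_ball.1 hall
  filter_upwards [Ioo_mem_nhdsGT hc₁] with c₀ hc₀
  have hgood : ∀ s ∈ Ioc 0 c₀, _ := fun s hs => hball s (by
    rw [Metric.mem_ball, dist_zero_right, Real.norm_of_nonneg hs.1.le]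
    exact lt_of_le_of_lt hs.2 hc₀.2) hs.1
  set e : ℝ := (N : ℝ) + lam.re with he
  have he0 : 0 < e := by positivity
  have hM : 0 < e / μ := by positivity
  have hβ : ∀ n m : ℕ, 0 < (((n : ℂ) + lam) / μ + m * κ).re := by
    intro n m
    have : (((n : ℂ) + lam) / μ + m * κ).re = (n + lam.re) / μ + m * κ := by
      rw [add_re, div_ofReal_re]; simp
    rw [this]
    have : 0 ≤ (m : ℝ) * κ := by positivity
    have : 0 < ((n : ℝ) + lam.re) / μ := by positivity
    linarith
  choose G hG hG0 hGinf using fun n m : ℕ => exists_primitive_logIntegrand hκ0 hκ1 hd0 hd (hβ n m) x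
  -- Any decay rate is available here; e/μ makes the endpoint error of the same order in ρ as the
  -- remainder.
  choose K₁ hK₁ hGinf using fun n m : ℕ => hGinf n m (e / μ) hM
  set Tn : ℝ := Real.exp (|lam.im| / μ * (|θ₁| + |θ₂|)) with hTn
  set P : ℝ := ‖cexp (Λ c₀)‖ with hP
  have hP0 : 0 < P := by simp [hP]
  set S : ℝ := ∑ n ∈ Finset.range N, ∑ m ∈ Finset.range (n + 1),
    Tn * ‖expCoeff b c n m‖ * (K₁ n m * P ^ (-(e / μ))) with hS
  refine ⟨K * (a ^ (-e / μ) * (1 / μ * Real.Gamma (e / μ))) + S, fun ρ hρ1 θ hθ' => ?_⟩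
  have hρ : 0 < ρ := by linarith
  have hterm : ∀ n m : ℕ, _ := fun n m : ℕ =>
    integrableOn_and_integral_logIntegrand (θ := θ) hμ hκ0 hκ1 hd0 hd (hβ n m) x hρ hc₀.1
      (fun s hs => (hgood s hs).1) (fun s hs => (hgood s hs).2.1)
      (fun s hs => (hgood s hs).2.2.1) (fun s hs => (hgood s hs).2.2.2.1)
      (fun s hs => (hgood s hs).2.2.2.2.1 θ hθ') (hG n m) (hG0 n m)
  set M : ℝ → ℂ := fun s => ∑ n ∈ Finset.range N, ∑ m ∈ Finset.range (n + 1),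
          cexp (-(((n : ℂ) + lam) / μ * polarLog ρ θ)) * expCoeff b c n m *
            (logIntegrand κ (((n : ℂ) + lam) / μ + m * κ) x (polarLog ρ θ + Λ s) * Λ' s) with hMdef
  have hMint : IntegrableOn M (Ioo 0 c₀) :=
    integrable_finsetSum _ fun n _ => integrable_finsetSum _ fun m _ => (hterm n m).1.const_mul _
  have hFcont : ContinuousOn (localIntegrand μ κ lam x Λ Λ' R Q ρ θ) (Ioo 0 c₀) := by
    intro s hs
    have g := hgood s (Ioo_subset_Ioc_self hs)
    have g1 := g.1.continuousAt
    have g2 := g.2.1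
    have g3 := g.2.2.2.2.2.1
    have g4 := g.2.2.2.2.2.2.1
    refine ContinuousAt.continuousWithinAt ?_
    unfold localIntegrand
    fun_prop
  obtain ⟨hki, hkv⟩ := integrableOn_rpow_mul_exp_neg hμ he0 (show 0 < a * ρ by positivity)
  have hsub : Ioo 0 c₀ ⊆ Ioi (0 : ℝ) := fun s hs => hs.1
  have hbound : ∀ᵐ s ∂(volume.restrict (Ioo 0 c₀)), ‖localIntegrand μ κ lam x Λ Λ' R Q ρ θ s - M s‖
      ≤ K * (s ^ (e - 1) * Real.exp (-(a * ρ) * s ^ μ)) :=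
    (ae_restrict_iff' measurableSet_Ioo).2 (ae_of_all _ fun s hs =>
      (hgood s (Ioo_subset_Ioc_self hs)).2.2.2.2.2.2.2 ρ hρ θ hθ')
  have hdiff : IntegrableOn (fun s => localIntegrand μ κ lam x Λ Λ' R Q ρ θ s - M s) (Ioo 0 c₀) :=
    Integrable.mono' ((hki.mono_set hsub).const_mul K)
      ((hFcont.aestronglyMeasurable measurableSet_Ioo).sub hMint.aestronglyMeasurable) hbound
  have hFint : IntegrableOn (localIntegrand μ κ lam x Λ Λ' R Q ρ θ) (Ioo 0 c₀) := by
    have := hdiff.add hMint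
    refine this.congr (ae_of_all _ fun s => ?_)
    simp
  refine ⟨hFint, ?_⟩
  -- The remainder bound at the single point `c₀` already forces the sign of `K`.
  have hK0 : 0 ≤ K := by
    have hp : c₀ ∈ Ioc 0 c₀ := ⟨hc₀.1, le_rfl⟩
    have := (norm_nonneg _).trans ((hgood c₀ hp).2.2.2.2.2.2.2 ρ hρ θ hθ')
    have hpos : 0 < c₀ ^ ((N : ℝ) + lam.re - 1) * Real.exp (-(a * ρ) * c₀ ^ μ) := by
      have := hc₀.1
      positivity
    exact nonneg_of_mul_nonneg_left this hpos
  have hR1 : ‖∫ s in Ioo 0 c₀, (localIntegrand μ κ lam x Λ Λ' R Q ρ θ s - M s)‖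
      ≤ K * (a ^ (-e / μ) * (1 / μ * Real.Gamma (e / μ))) * ρ ^ (-(e / μ)) := by
    calc _ ≤ ∫ s in Ioo 0 c₀, K * (s ^ (e - 1) * Real.exp (-(a * ρ) * s ^ μ)) :=
          norm_integral_le_of_norm_le ((hki.mono_set hsub).const_mul K) hbound
      _ = K * ∫ s in Ioo 0 c₀, (s ^ (e - 1) * Real.exp (-(a * ρ) * s ^ μ)) :=
          integral_const_mul _ _
      _ ≤ K * ∫ s in Ioi 0, (s ^ (e - 1) * Real.exp (-(a * ρ) * s ^ μ)) := by
          refine mul_le_mul_of_nonneg_left (setIntegral_mono_set hki ?_ hsub.eventuallyLE) hK0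
          refine (ae_restrict_iff' measurableSet_Ioi).2 (ae_of_all _ fun s hs => ?_)
          have : (0 : ℝ) < s := hs
          simp only [Pi.zero_apply]
          positivity
      _ = _ := by
          rw [hkv, Real.mul_rpow ha.le hρ.le, neg_div]; ring
  have hMval : ∫ s in Ioo 0 c₀, M s = ∑ n ∈ Finset.range N, ∑ m ∈ Finset.range (n + 1),
      cexp (-(((n : ℂ) + lam) / μ * polarLog ρ θ)) * expCoeff b c n m *
        G n m (polarLog ρ θ + Λ c₀) := by
    rw [hMdef, integral_finsetSum _ fun n _ => integrable_finsetSum _ fun m _ =>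
      (hterm n m).1.const_mul _]
    refine Finset.sum_congr rfl fun n _ => ?_
    rw [integral_finsetSum _ fun m _ => (hterm n m).1.const_mul _]
    refine Finset.sum_congr rfl fun m _ => ?_
    rw [integral_const_mul, (hterm n m).2]
  have hR2 : ‖(∫ s in Ioo 0 c₀, M s) - localSum μ κ lam x b c N ρ θ‖ ≤ S * ρ ^ (-(e / μ)) := by
    rw [hMval, localSum, ← Finset.sum_sub_distrib, hS, Finset.sum_mul]
    refine (norm_sum_le _ _).trans (Finset.sum_le_sum fun n _ => ?_)
    rw [← Finset.sum_sub_distrib, Finset.sum_mul]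
    refine (norm_sum_le _ _).trans (Finset.sum_le_sum fun m _ => ?_)
    rw [← mul_sub, norm_mul, norm_mul]
    -- As ρ ≥ 1, the modulus ρ^(-(n + Re λ)/μ) can be dropped; only the bounded contribution of Im λ
    -- remains.
    have h1 : ‖cexp (-(((n : ℂ) + lam) / μ * polarLog ρ θ))‖ ≤ Tn := by
      rw [norm_exp, hTn, Real.exp_le_exp, neg_re, mul_re, div_ofReal_re, div_ofReal_im]
      simp only [polarLog, add_re, add_im, ofReal_re, ofReal_im, mul_re, mul_im, I_re, I_im,
        natCast_re, natCast_im, mul_zero, mul_one, zero_add, add_zero, sub_zero]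
      have h2 : 0 ≤ (n + lam.re) / μ * Real.log ρ := by
        have := Real.log_nonneg hρ1
        positivity
      have h3 : lam.im / μ * θ ≤ |lam.im| / μ * (|θ₁| + |θ₂|) := by
        refine (le_abs_self _).trans ?_
        rw [abs_mul, abs_div, abs_of_pos hμ]
        gcongr
        exact (abs_le_max_abs_abs hθ'.1 hθ'.2).trans
          (max_le_add_of_nonneg (abs_nonneg _) (abs_nonneg _))
      linarith
    have h2 : ‖G n m (polarLog ρ θ + Λ c₀) - faxen κ (((n : ℂ) + lam) / μ + m * κ) x‖
        ≤ K₁ n m * P ^ (-(e / μ)) * ρ ^ (-(e / μ)) := by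
      refine (hGinf n m _ ?_).trans (le_of_eq ?_)
      · have : (polarLog ρ θ + Λ c₀).im = (Λ c₀).im + θ := by simp [polarLog, add_comm]
        rw [this]
        exact (hgood c₀ ⟨hc₀.1, le_rfl⟩).2.2.2.2.1 θ hθ'
      · rw [mul_assoc, ← Real.mul_rpow hP0.le hρ.le, mul_comm P ρ, hP,
          ← norm_exp_polarLog_add hρ θ, norm_exp, ← Real.exp_mul]
        ring_nf
    calc _ ≤ Tn * ‖expCoeff b c n m‖ * (K₁ n m * P ^ (-(e / μ)) * ρ ^ (-(e / μ))) := by gcongr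
      _ = _ := by ring
  have hsplit : (∫ s in Ioo 0 c₀, localIntegrand μ κ lam x Λ Λ' R Q ρ θ s)
      - localSum μ κ lam x b c N ρ θ
      = (∫ s in Ioo 0 c₀, (localIntegrand μ κ lam x Λ Λ' R Q ρ θ s - M s))
        + ((∫ s in Ioo 0 c₀, M s) - localSum μ κ lam x b c N ρ θ) := by
    rw [integral_sub hFint hMint]; ring
  rw [hsplit, add_mul]
  exact (norm_add_le _ _).trans (add_le_add hR1 hR2)

/-! ### The contour and its continuous logarithm near the starting point -/

section

theorem hasDerivAt_of_contDiffOn_Icc {γ : ℝ → ℂ} {α β s : ℝ} (h : ContDiffOn ℝ 1 γ (Icc α β))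
    (hs : s ∈ Ioo α β) : HasDerivAt γ (derivWithin γ (Icc α β) s) s :=
  ((h.differentiableOn one_ne_zero s (Ioo_subset_Icc_self hs)).hasDerivWithinAt).hasDerivAt
    (Icc_mem_nhds hs.1 hs.2)

theorem continuousOn_derivWithin_of_contDiffOn_Icc {γ : ℝ → ℂ} {α β : ℝ} (hαβ : α < β)
    (h : ContDiffOn ℝ 1 γ (Icc α β)) : ContinuousOn (derivWithin γ (Icc α β)) (Icc α β) :=
  h.continuousOn_derivWithin (uniqueDiffOn_Icc hαβ) le_rfl

theorem continuousAt_deriv_of_contDiffOn_Icc {γ : ℝ → ℂ} {α β s : ℝ}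
    (h : ContDiffOn ℝ 1 γ (Icc α β)) (hs : s ∈ Ioo α β) : ContinuousAt (deriv γ) s := by
  have h1 := (continuousOn_derivWithin_of_contDiffOn_Icc (hs.1.trans hs.2) h).continuousAt
    (Icc_mem_nhds hs.1 hs.2)
  refine h1.congr ?_
  filter_upwards [Ioo_mem_nhds hs.1 hs.2] with t ht
  exact (hasDerivAt_of_contDiffOn_Icc h ht).deriv.symm

variable {γ : ℝ → ℂ} {a : ℂ} {b : OnePoint ℂ} {ϖ : ℝ} {φ : ℝ → ℝ}

/-- Regularity of the first arc gives a nonzero one-sided tangent, which makes |t - a| comparable to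
the parameter s. -/
theorem IsContour.exists_tangent (hγ : IsContour γ a b) : ∃ D : ℂ, D ≠ 0 ∧
    (∀ᶠ s in 𝓝[>] (0 : ℝ), HasDerivAt γ (deriv γ s) s) ∧
    (∀ᶠ s in 𝓝[>] (0 : ℝ), ContinuousAt (deriv γ) s) ∧
    Tendsto (deriv γ) (𝓝[>] 0) (𝓝 D) ∧
    Tendsto (fun s => ‖γ s - a‖ / s) (𝓝[>] 0) (𝓝 ‖D‖) := by
  obtain ⟨σ, hσ, hσ0, -, harc⟩ := hγ.arcs
  obtain ⟨hc, hd⟩ := harc 0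
  rw [hσ0, zero_add] at hc hd
  have h1 : 0 < σ 1 := by rw [← hσ0]; exact hσ zero_lt_one
  have hmem : Ioo 0 (σ 1) ∈ 𝓝[>] (0 : ℝ) := Ioo_mem_nhdsGT h1
  have h0 : (0 : ℝ) ∈ Icc 0 (σ 1) := ⟨le_rfl, h1.le⟩
  refine ⟨derivWithin γ (Icc 0 (σ 1)) 0, hd 0 h0, ?_, ?_, ?_, ?_⟩
  · filter_upwards [hmem] with s hs
    exact (hasDerivAt_of_contDiffOn_Icc hc hs).differentiableAt.hasDerivAt
  · filter_upwards [hmem] with s hs using continuousAt_deriv_of_contDiffOn_Icc hc hs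
  · have h2 := (continuousOn_derivWithin_of_contDiffOn_Icc h1 hc) 0 h0
    have h3 : Tendsto (derivWithin γ (Icc 0 (σ 1))) (𝓝[>] 0)
        (𝓝 (derivWithin γ (Icc 0 (σ 1)) 0)) :=
      h2.mono_left (nhdsWithin_le_of_mem (mem_of_superset hmem Ioo_subset_Icc_self))
    refine h3.congr' ?_
    filter_upwards [hmem] with s hs using (hasDerivAt_of_contDiffOn_Icc hc hs).deriv.symm
  · have h2 := (hc.differentiableOn one_ne_zero 0 h0).hasDerivWithinAt
    rw [hasDerivWithinAt_iff_tendsto_slope] at h2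
    have h3 : Tendsto (slope γ 0) (𝓝[>] 0) (𝓝 (derivWithin γ (Icc 0 (σ 1)) 0)) := by
      refine h2.mono_left (nhdsWithin_le_of_mem (mem_of_superset hmem fun s hs => ?_))
      exact ⟨Ioo_subset_Icc_self hs, hs.1.ne'⟩
    refine h3.norm.congr' ?_
    filter_upwards [hmem] with s hs
    rw [slope_def_module, norm_smul, hγ.start, sub_zero, norm_inv, Real.norm_of_nonneg hs.1.le]
    ring

theorem IsContour.tendsto_sub (hγ : IsContour γ a b) :
    Tendsto (fun s => γ s - a) (𝓝[>] 0) (𝓝 0) := by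
  obtain ⟨D, -, -, -, -, h⟩ := hγ.exists_tangent
  rw [tendsto_zero_iff_norm_tendsto_zero]
  have h1 : Tendsto (fun s : ℝ => s) (𝓝[>] 0) (𝓝 0) := tendsto_id.mono_left nhdsWithin_le_nhds
  have h2 := h.mul h1
  rw [mul_zero] at h2
  refine h2.congr' ?_
  filter_upwards [self_mem_nhdsWithin] with s hs
  have : s ≠ 0 := ne_of_gt hs
  field_simp

theorem IsContour.eventually_bounds (hγ : IsContour γ a b) : ∃ m M : ℝ, 0 < m ∧ 0 < M ∧
    ∀ᶠ s in 𝓝[>] (0 : ℝ), m * s ≤ ‖γ s - a‖ ∧ ‖γ s - a‖ ≤ M * s ∧ ‖deriv γ s‖ ≤ M := by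
  obtain ⟨D, hD, -, -, h1, h2⟩ := hγ.exists_tangent
  have hD' : 0 < ‖D‖ := norm_pos_iff.2 hD
  refine ⟨‖D‖ / 2, 2 * ‖D‖, by positivity, by positivity, ?_⟩
  filter_upwards [h2.eventually_const_le (show ‖D‖ / 2 < ‖D‖ by linarith),
    h2.eventually_le_const (show ‖D‖ < 2 * ‖D‖ by linarith),
    h1.norm.eventually_le_const (show ‖D‖ < 2 * ‖D‖ by linarith), self_mem_nhdsWithin]
    with s e1 e2 e3 hs
  have hs' : 0 < s := hs
  exact ⟨(le_div_iff₀ hs').1 e1, (div_le_iff₀ hs').1 e2, e3⟩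

theorem IsContour.eventually_ne (hγ : IsContour γ a b) : ∀ᶠ s in 𝓝[>] (0 : ℝ), γ s - a ≠ 0 := by
  obtain ⟨m, M, hm, -, h⟩ := hγ.eventually_bounds
  filter_upwards [h, self_mem_nhdsWithin] with s hs hs0
  have : 0 < m * s := mul_pos hm hs0
  exact norm_pos_iff.1 (this.trans_le hs.1)

/-- The continuous logarithm of `t - a` along the contour `t = γ s`. -/
def pathLog (γ : ℝ → ℂ) (a : ℂ) (φ : ℝ → ℝ) (s : ℝ) : ℂ := polarLog ‖γ s - a‖ (φ s)

theorem IsArgAlong.exp_pathLog (hφ : IsArgAlong γ a ϖ φ) {s : ℝ} (hs : s ∈ Ioo (0 : ℝ) 1)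
    (hne : γ s - a ≠ 0) : cexp (pathLog γ a φ s) = γ s - a := by
  rw [pathLog, exp_polarLog (norm_pos_iff.2 hne), ← hφ.polar s hs]

/-- By continuity Im(u t - u s) stays in (-π, π), so u t - u s is the principal logarithm of x t / x
s, which is differentiable near 1. -/
theorem hasDerivAt_of_exp_eq {u x : ℝ → ℂ} {x' : ℂ} {s : ℝ} (hu : ContinuousAt u s)
    (hx : HasDerivAt x x' s) (h : ∀ᶠ t in 𝓝 s, cexp (u t) = x t) :
    HasDerivAt u (x' / x s) s := by
  have hxs : x s ≠ 0 := by rw [← h.self_of_nhds]; exact Complex.exp_ne_zero _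
  have him : Tendsto (fun t => (u t - u s).im) (𝓝 s) (𝓝 0) := by
    have : ContinuousAt (fun t => (u t - u s).im) s :=
      continuous_im.continuousAt.comp (hu.sub continuousAt_const)
    simpa [ContinuousAt] using this
  have hlog : HasDerivAt (fun t => u s + Complex.log (x t / x s)) (x' / x s) s := by
    have h1 := (hx.div_const (x s)).clog_real (by rw [div_self hxs]; exact one_mem_slitPlane)
    rw [div_self hxs, div_one] at h1
    exact h1.const_add _
  refine hlog.congr_of_eventuallyEq ?_
  filter_upwards [h, him.eventually_lt_const Real.pi_pos,
    him.eventually_const_lt (neg_lt_zero.2 Real.pi_pos)] with t ht h1 h2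
  rw [← ht, ← h.self_of_nhds, ← Complex.exp_sub, Complex.log_exp h2 h1.le]
  ring

theorem IsArgAlong.hasDerivAt_pathLog (hφ : IsArgAlong γ a ϖ φ) (hγ : IsContour γ a b) :
    ∀ᶠ s in 𝓝[>] (0 : ℝ), HasDerivAt (pathLog γ a φ) (deriv γ s / (γ s - a)) s := by
  obtain ⟨D, hD, h1, h2, -, -⟩ := hγ.exists_tangent
  have hall := (h1.and hγ.eventually_ne).and (Ioo_mem_nhdsGT (one_pos (α := ℝ)))
  obtain ⟨ε, hε, hball⟩ := mem_nhdsGT_iff_exists_Ioo_subset.1 hall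
  filter_upwards [Ioo_mem_nhdsGT hε] with s hs
  obtain ⟨⟨hd, hne⟩, hs1⟩ := hball hs
  refine hasDerivAt_of_exp_eq ?_ (hd.sub_const a) ?_
  · have c1 : ContinuousAt φ s := hφ.cont.continuousAt (Ioo_mem_nhds hs1.1 hs1.2)
    have c2 : ContinuousAt (fun s => Real.log ‖γ s - a‖) s :=
      ((hd.continuousAt.sub continuousAt_const).norm).log (norm_ne_zero_iff.2 hne)
    exact (continuous_ofReal.continuousAt.comp c2).add
      ((continuous_ofReal.continuousAt.comp c1).mul continuousAt_const)
  · filter_upwards [Ioo_mem_nhds hs.1 hs.2] with t ht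
    obtain ⟨⟨-, hne⟩, ht1⟩ := hball ht
    exact hφ.exp_pathLog ht1 hne

/-- Pulling out the common factor (t - a)^e leaves an ordinary power series at the nonzero point t -
a; its convergence there yields analyticity around 0. -/
theorem HasExpansion.eventually_eq (hφ : IsArgAlong γ a ϖ φ) (hγ : IsContour γ a b) {e : ℂ}
    {c : ℕ → ℂ} {f : ℂ → ℂ} (hf : HasExpansion γ a φ e c f) :
    ∀ᶠ s in 𝓝[>] (0 : ℝ), (Summable fun n => c n * (γ s - a) ^ n) ∧
      f (γ s) = cexp (e * pathLog γ a φ s) * powerSum c (γ s - a) := by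
  filter_upwards [hf, hγ.eventually_ne, Ioo_mem_nhdsGT (one_pos (α := ℝ))] with s h hne hs
  have he : (fun n : ℕ => c n * polarPow ‖γ s - a‖ (φ s) ((n : ℂ) + e))
      = fun n => cexp (e * pathLog γ a φ s) * (c n * (γ s - a) ^ n) := by
    ext n
    rw [polarPow_eq_exp, ← pathLog, add_mul, Complex.exp_add, Complex.exp_nat_mul,
      hφ.exp_pathLog hs hne]
    ring
  rw [he] at h
  have hsum : Summable fun n => c n * (γ s - a) ^ n :=
    (summable_mul_left_iff (Complex.exp_ne_zero _)).1 h.summable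
  exact ⟨hsum, h.unique (hsum.hasSum.mul_left _)⟩

theorem HasExpansion.exists_summable (hφ : IsArgAlong γ a ϖ φ) (hγ : IsContour γ a b)
    {e₁ e₂ e₃ : ℂ} {c₁ c₂ c₃ : ℕ → ℂ} {f₁ f₂ f₃ : ℂ → ℂ} (h₁ : HasExpansion γ a φ e₁ c₁ f₁)
    (h₂ : HasExpansion γ a φ e₂ c₂ f₂) (h₃ : HasExpansion γ a φ e₃ c₃ f₃) :
    ∃ x₀ : ℂ, x₀ ≠ 0 ∧ (Summable fun n => c₁ n * x₀ ^ n) ∧ (Summable fun n => c₂ n * x₀ ^ n) ∧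
      Summable fun n => c₃ n * x₀ ^ n := by
  obtain ⟨s, hs, g₁, g₂, g₃⟩ := (hγ.eventually_ne.and ((h₁.eventually_eq hφ hγ).and
    ((h₂.eventually_eq hφ hγ).and (h₃.eventually_eq hφ hγ)))).exists
  exact ⟨γ s - a, hs, g₁.1, g₂.1, g₃.1⟩

/-! ### The continuous logarithm of p(t) - p(a) along the contour -/

section

variable {pc : ℕ → ℂ} {μ ϖ₀ : ℝ} {x₀ : ℂ}

/-- The continuous logarithm of `p(t) - p(a)` along the contour `t = γ s`. -/
def phaseLogAlong (γ : ℝ → ℂ) (a : ℂ) (φ : ℝ → ℝ) (pc : ℕ → ℂ) (μ ϖ₀ : ℝ) (s : ℝ) : ℂ :=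
  μ * pathLog γ a φ s + localLog pc ϖ₀ (γ s - a)

/-- The derivative of `phaseLogAlong`. -/
def phaseLogAlongDeriv (γ : ℝ → ℂ) (a : ℂ) (pc : ℕ → ℂ) (μ ϖ₀ : ℝ) (s : ℝ) : ℂ :=
  deriv γ s / (γ s - a) * (μ + (γ s - a) * deriv (localLog pc ϖ₀) (γ s - a))

theorem hasDerivAt_phaseLogAlong (hφ : IsArgAlong γ a ϖ φ) (hγ : IsContour γ a b) (hx₀ : x₀ ≠ 0)
    (hp : Summable fun n => pc n * x₀ ^ n) (hp0 : pc 0 ≠ 0) (μ ϖ₀ : ℝ) :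
    ∀ᶠ s in 𝓝[>] (0 : ℝ), HasDerivAt (phaseLogAlong γ a φ pc μ ϖ₀)
      (phaseLogAlongDeriv γ a pc μ ϖ₀ s) s := by
  obtain ⟨D, hD, h1, -, -, -⟩ := hγ.exists_tangent
  filter_upwards [hφ.hasDerivAt_pathLog hγ, h1, hγ.eventually_ne,
    hγ.tendsto_sub.eventually (analyticAt_localLog hx₀ hp hp0 ϖ₀).eventually_analyticAt]
    with s h2 h3 hne hL
  have h4 : HasDerivAt (fun s => localLog pc ϖ₀ (γ s - a))
      (deriv (localLog pc ϖ₀) (γ s - a) * deriv γ s) s :=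
    HasDerivAt.comp (h := fun s => γ s - a) (h₂ := localLog pc ϖ₀) s
      hL.differentiableAt.hasDerivAt (h3.sub_const a)
  refine ((h2.const_mul (μ : ℂ)).add h4).congr_deriv ?_
  rw [phaseLogAlongDeriv]
  field_simp

theorem continuousAt_phaseLogAlongDeriv (hγ : IsContour γ a b) (hx₀ : x₀ ≠ 0)
    (hp : Summable fun n => pc n * x₀ ^ n) (hp0 : pc 0 ≠ 0) (μ ϖ₀ : ℝ) :
    ∀ᶠ s in 𝓝[>] (0 : ℝ), ContinuousAt (phaseLogAlongDeriv γ a pc μ ϖ₀) s := by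
  obtain ⟨D, hD, h1, h2, -, -⟩ := hγ.exists_tangent
  filter_upwards [h1, h2, hγ.eventually_ne,
    hγ.tendsto_sub.eventually (analyticAt_localLog hx₀ hp hp0 ϖ₀).eventually_analyticAt]
    with s h3 h4 hne hL
  have h5 : ContinuousAt (fun s => γ s - a) s := h3.continuousAt.sub continuousAt_const
  have h6 : ContinuousAt (fun s => deriv (localLog pc ϖ₀) (γ s - a)) s :=
    ContinuousAt.comp (f := fun s => γ s - a) hL.deriv.continuousAt h5
  exact (h4.div h5 hne).mul (continuousAt_const.add (h5.mul h6))

theorem norm_exp_pathLog_mul (hφ : IsArgAlong γ a ϖ φ) {s : ℝ} (hs : s ∈ Ioo (0 : ℝ) 1)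
    (hne : γ s - a ≠ 0) (μ : ℝ) : ‖cexp (μ * pathLog γ a φ s)‖ = ‖γ s - a‖ ^ μ := by
  rw [norm_exp_real_mul, hφ.exp_pathLog hs hne]

theorem exp_phaseLogAlong (hγ : IsContour γ a b) (hx₀ : x₀ ≠ 0)
    (hp : Summable fun n => pc n * x₀ ^ n) (hp0 : pc 0 ≠ 0)
    (hϖ : pc 0 = (‖pc 0‖ : ℂ) * cexp ((ϖ₀ : ℂ) * I)) (φ : ℝ → ℝ) (μ : ℝ) :
    ∀ᶠ s in 𝓝[>] (0 : ℝ), cexp (phaseLogAlong γ a φ pc μ ϖ₀ s)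
      = cexp (μ * pathLog γ a φ s) * powerSum pc (γ s - a) := by
  filter_upwards [hγ.tendsto_sub.eventually (eventually_powerSum_ne_zero hx₀ hp hp0)] with s hs
  rw [phaseLogAlong, Complex.exp_add, exp_localLog hp0 hϖ hs]

theorem exists_norm_exp_phaseLogAlong_bounds (hφ : IsArgAlong γ a ϖ φ) (hγ : IsContour γ a b)
    (hx₀ : x₀ ≠ 0) (hp : Summable fun n => pc n * x₀ ^ n) (hp0 : pc 0 ≠ 0)
    (hϖ : pc 0 = (‖pc 0‖ : ℂ) * cexp ((ϖ₀ : ℂ) * I)) (hμ : 0 < μ) :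
    ∃ m₁ m₂ m₃ : ℝ, 0 < m₁ ∧ 0 < m₂ ∧
      (∀ᶠ s in 𝓝[>] (0 : ℝ), m₁ * s ^ μ ≤ ‖cexp (phaseLogAlong γ a φ pc μ ϖ₀ s)‖) ∧
      (∀ᶠ s in 𝓝[>] (0 : ℝ), ‖cexp (phaseLogAlong γ a φ pc μ ϖ₀ s)‖ ≤ m₂ * s ^ μ) ∧
      (∀ᶠ s in 𝓝[>] (0 : ℝ), ‖phaseLogAlongDeriv γ a pc μ ϖ₀ s‖ ≤ m₃ / s) := by
  obtain ⟨m, M, hm, hM, hb⟩ := hγ.eventually_bounds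
  have hpn : 0 < ‖pc 0‖ := norm_pos_iff.2 hp0
  have hg : Tendsto (fun s => ‖powerSum pc (γ s - a)‖) (𝓝[>] 0) (𝓝 ‖pc 0‖) := by
    have := ((hasFPowerSeriesAt_powerSum hx₀ hp).analyticAt.continuousAt.tendsto.comp
      hγ.tendsto_sub).norm
    rwa [powerSum_zero] at this
  have hden : Tendsto (fun s => ‖(μ : ℂ) + (γ s - a) * deriv (localLog pc ϖ₀) (γ s - a)‖)
      (𝓝[>] 0) (𝓝 μ) := by
    have h : AnalyticAt ℂ (fun x => (μ : ℂ) + x * deriv (localLog pc ϖ₀) x) 0 :=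
      analyticAt_const.add (analyticAt_id.mul (analyticAt_localLog hx₀ hp hp0 ϖ₀).deriv)
    have := (h.continuousAt.tendsto.comp hγ.tendsto_sub).norm
    simpa [abs_of_pos hμ] using this
  have hexp := exp_phaseLogAlong hγ hx₀ hp hp0 hϖ φ μ
  have h01 := Ioo_mem_nhdsGT (one_pos (α := ℝ))
  refine ⟨m ^ μ * (‖pc 0‖ / 2), M ^ μ * (2 * ‖pc 0‖), M * (2 * μ) / m, by positivity,
    by positivity, ?_, ?_, ?_⟩
  · filter_upwards [hb, hexp, hγ.eventually_ne, h01,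
      hg.eventually_const_le (show ‖pc 0‖ / 2 < ‖pc 0‖ by linarith)] with s h1 h2 h3 hs h4
    rw [h2, norm_mul, norm_exp_pathLog_mul hφ hs h3]
    calc _ = (m * s) ^ μ * (‖pc 0‖ / 2) := by rw [Real.mul_rpow hm.le hs.1.le]; ring
      _ ≤ _ := by
        have := mul_pos hm hs.1
        gcongr
        exact h1.1
  · filter_upwards [hb, hexp, hγ.eventually_ne, h01,
      hg.eventually_le_const (show ‖pc 0‖ < 2 * ‖pc 0‖ by linarith)] with s h1 h2 h3 hs h4
    rw [h2, norm_mul, norm_exp_pathLog_mul hφ hs h3]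
    calc _ ≤ (M * s) ^ μ * (2 * ‖pc 0‖) := by
          have := mul_pos hM hs.1
          gcongr
          exact h1.2.1
      _ = _ := by rw [Real.mul_rpow hM.le hs.1.le]; ring
  · filter_upwards [hb, h01, hden.eventually_le_const (show μ < 2 * μ by linarith)] with s h1 hs h4
    rw [phaseLogAlongDeriv, norm_mul, norm_div]
    have := mul_pos hm hs.1
    calc _ ≤ M / (m * s) * (2 * μ) := by
          gcongr
          · exact h1.2.2
          · exact h1.1
      _ = _ := by field_simp

theorem tendsto_im_phaseLogAlong (hφ : IsArgAlong γ a ϖ φ) (hγ : IsContour γ a b)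
    (hx₀ : x₀ ≠ 0) (hp : Summable fun n => pc n * x₀ ^ n) (hp0 : pc 0 ≠ 0) (μ ϖ₀ : ℝ) :
    Tendsto (fun s => (phaseLogAlong γ a φ pc μ ϖ₀ s).im) (𝓝[>] 0) (𝓝 (ϖ₀ + μ * ϖ)) := by
  have h1 := (analyticAt_localLog hx₀ hp hp0 ϖ₀).continuousAt.tendsto.comp hγ.tendsto_sub
  have h2 := (continuous_im.tendsto _).comp h1
  have h3 := (hφ.slope.const_mul μ).add h2
  have h4 : (localLog pc ϖ₀ 0).im = ϖ₀ := by
    rw [localLog_zero hp0]; simp [phaseLog]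
  rw [h4, add_comm] at h3
  refine h3.congr fun s => ?_
  simp [phaseLogAlong, pathLog, polarLog]

theorem exp_phaseLogAlong_div (hφ : IsArgAlong γ a ϖ φ) (hγ : IsContour γ a b) (hμ : μ ≠ 0)
    (pc : ℕ → ℂ) (ϖ₀ : ℝ) : ∀ᶠ s in 𝓝[>] (0 : ℝ), cexp (phaseLogAlong γ a φ pc μ ϖ₀ s / μ)
      = (γ s - a) * localRoot pc ϖ₀ μ (γ s - a) := by
  filter_upwards [hγ.eventually_ne, Ioo_mem_nhdsGT (one_pos (α := ℝ))] with s hne hs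
  have hμ' : (μ : ℂ) ≠ 0 := by exact_mod_cast hμ
  rw [phaseLogAlong, add_div, mul_div_cancel_left₀ _ hμ', Complex.exp_add, hφ.exp_pathLog hs hne,
    localRoot]

theorem tendsto_exp_phaseLogAlong_div (hφ : IsArgAlong γ a ϖ φ) (hγ : IsContour γ a b)
    (hx₀ : x₀ ≠ 0) (hp : Summable fun n => pc n * x₀ ^ n) (hp0 : pc 0 ≠ 0) (hμ : μ ≠ 0)
    (ϖ₀ : ℝ) : Tendsto (fun s => cexp (phaseLogAlong γ a φ pc μ ϖ₀ s / μ)) (𝓝[>] 0) (𝓝 0) := by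
  have h := (((continuousAt_id (x := (0 : ℂ))).mul
    (analyticAt_localRoot hx₀ hp hp0 ϖ₀ μ).continuousAt).tendsto.comp hγ.tendsto_sub)
  simp only [id, zero_mul, Pi.mul_apply] at h
  refine h.congr' ?_
  filter_upwards [exp_phaseLogAlong_div hφ hγ hμ pc ϖ₀] with s hs using hs.symm

/-- Here y is the local coordinate h at t - a, so repeated division by h is the expansion in y, and
the last quotient is bounded because it is analytic at 0. -/
theorem hasTrunc_comp (hφ : IsArgAlong γ a ϖ φ) (hγ : IsContour γ a b) (hx₀ : x₀ ≠ 0)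
    (hp : Summable fun n => pc n * x₀ ^ n) (hp0 : pc 0 ≠ 0) (hμ : μ ≠ 0) (ϖ₀ : ℝ) {A : ℂ → ℂ}
    (hA : AnalyticAt ℂ A 0) :
    HasTrunc (𝓝[>] 0) (fun s => cexp (phaseLogAlong γ a φ pc μ ϖ₀ s / μ)) (fun s => A (γ s - a))
      (PowerSeries.mk fun n => quotSeq (localRoot pc ϖ₀ μ) A n 0) := by
  intro N
  have h1 : (fun s => quotSeq (localRoot pc ϖ₀ μ) A N (γ s - a)) =O[𝓝[>] 0] fun _ => (1 : ℂ) :=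
    ((analyticAt_quotSeq (analyticAt_localRoot hx₀ hp hp0 ϖ₀ μ) (localRoot_ne_zero _ _ _ _)
      hA N).continuousAt.tendsto.comp hγ.tendsto_sub).isBigO_one ℂ
  have h2 := (Asymptotics.isBigO_refl
    (fun s => cexp (phaseLogAlong γ a φ pc μ ϖ₀ s / μ) ^ N) (𝓝[>] 0)).mul h1
  simp only [mul_one] at h2
  refine h2.congr' ?_ EventuallyEq.rfl
  filter_upwards [exp_phaseLogAlong_div hφ hγ hμ pc ϖ₀] with s hs
  rw [eq_sum_add_quotSeq (A := A) (localRoot_ne_zero pc ϖ₀ μ (γ s - a)) N, hs]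
  simp [PowerSeries.coeff_mk]

end

theorem HasTrunc.sub_const {ι : Type*} {l : Filter ι} {y f : ι → ℂ} {a : PowerSeries ℂ}
    (hf : HasTrunc l y f a) : HasTrunc l y (fun s => f s - PowerSeries.coeff 0 a)
      (PowerSeries.mk fun k => if k = 0 then 0 else PowerSeries.coeff k a) := by
  intro N
  rcases N with _ | N
  · simpa using hf.isBigO_one.sub
      ((Asymptotics.isBigO_refl (fun _ : ι => (1 : ℂ)) l).const_mul_left (PowerSeries.coeff 0 a))
  · refine (hf (N + 1)).congr_left fun s => ?_
    rw [Finset.sum_range_succ', Finset.sum_range_succ']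
    simp
    ring

end

/-! ### The phase of p₀ and the contribution of a neighbourhood of a -/

section

variable {γ : ℝ → ℂ} {a : ℂ} {b : OnePoint ℂ} {ϖ : ℝ} {φ : ℝ → ℝ}

theorem norm_mul_sin_le_re {v : ℂ} {δ : ℝ} (hδ : 0 < δ) (h : |arg v| ≤ Real.pi / 2 - δ) :
    ‖v‖ * Real.sin δ ≤ v.re := by
  rw [← norm_mul_cos_arg v, ← Real.cos_pi_div_two_sub, ← Real.cos_abs (arg v)]
  gcongr
  exact Real.cos_le_cos_of_nonneg_of_le_pi (abs_nonneg _) (by linarith [Real.pi_pos]) h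

/-- Divide the sector condition by |p(t) - p(a)| and let t → a: the phase of e^(iθ)(p(t) - p(a))
tends to ϖ₀ + θ + μϖ. Any determination ϖ₀ of arg p₀ is allowed. -/
theorem sin_le_cos_leading {p : ℂ → ℂ} {pc : ℕ → ℂ} {μ ϖ₀ δ θ : ℝ} {x₀ : ℂ}
    (hφ : IsArgAlong γ a ϖ φ) (hγ : IsContour γ a b) (hx₀ : x₀ ≠ 0)
    (hp : Summable fun n => pc n * x₀ ^ n) (hp0 : pc 0 ≠ 0)
    (hpe : HasExpansion γ a φ μ pc (fun t => p t - p a))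
    (hϖ : pc 0 = (‖pc 0‖ : ℂ) * cexp ((ϖ₀ : ℂ) * I))
    (hre : ∀ s ∈ Ioo (0 : ℝ) 1, ‖p (γ s) - p a‖ * Real.sin δ
      ≤ (cexp ((θ : ℂ) * I) * p (γ s) - cexp ((θ : ℂ) * I) * p a).re) :
    Real.sin δ ≤ Real.cos (ϖ₀ + θ + μ * ϖ) := by
  have h1 := (Real.continuous_cos.tendsto _).comp
    ((tendsto_im_phaseLogAlong hφ hγ hx₀ hp hp0 μ ϖ₀).add_const θ)
  rw [show ϖ₀ + μ * ϖ + θ = ϖ₀ + θ + μ * ϖ by ring] at h1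
  refine ge_of_tendsto h1 ?_
  filter_upwards [hpe.eventually_eq hφ hγ, exp_phaseLogAlong hγ hx₀ hp hp0 hϖ φ μ,
    Ioo_mem_nhdsGT (one_pos (α := ℝ))] with s h2 h3 hs
  have h4 := hre s hs
  rw [← mul_sub, h2.2, ← h3, ← Complex.exp_add, exp_re, norm_exp] at h4
  simp only [Function.comp]
  have h5 : ((θ : ℂ) * I + phaseLogAlong γ a φ pc μ ϖ₀ s).re
      = (phaseLogAlong γ a φ pc μ ϖ₀ s).re := by simp
  have h6 : ((θ : ℂ) * I + phaseLogAlong γ a φ pc μ ϖ₀ s).im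
      = (phaseLogAlong γ a φ pc μ ϖ₀ s).im + θ := by simp [add_comm]
  rw [h5, h6] at h4
  exact le_of_mul_le_mul_left h4 (Real.exp_pos _)

theorem abs_le_of_sin_le_cos {δ t : ℝ} (hδ : δ ≤ Real.pi / 2)
    (ht : |t| ≤ Real.pi / 2) (h : Real.sin δ ≤ Real.cos t) : |t| ≤ Real.pi / 2 - δ := by
  by_contra! hlt
  have := Real.cos_lt_cos_of_nonneg_of_le_pi_div_two (by linarith) ht hlt
  rw [Real.cos_pi_div_two_sub, Real.cos_abs] at this
  linarith

/-- Reduce the phase at θ₁ modulo 2π into (-π, π]; the positive cosine puts it in (-π/2, π/2).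
Increasing θ by less than π cannot carry it past π/2 without meeting a nonpositive cosine. Two
solutions differ by a multiple of 2π of modulus at most π. -/
theorem existsUnique_isLeadingArg {p₀ : ℂ} {μ ϖ θ₁ θ₂ : ℝ} (hp0 : p₀ ≠ 0) (hθ : θ₁ ≤ θ₂)
    (hθπ : θ₂ - θ₁ < Real.pi)
    (hcos : ∀ ϖ₀ : ℝ, p₀ = (‖p₀‖ : ℂ) * cexp ((ϖ₀ : ℂ) * I) →
      ∀ θ ∈ Icc θ₁ θ₂, 0 < Real.cos (ϖ₀ + θ + μ * ϖ)) :
    ∃! ϖ₀ : ℝ, IsLeadingArg p₀ μ ϖ θ₁ θ₂ ϖ₀ := by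
  refine existsUnique_of_exists_of_unique ?_ ?_
  · set t := arg p₀ + θ₁ + μ * ϖ with ht
    set k := toIocDiv Real.two_pi_pos (-Real.pi) t with hk
    set ϖ₀ : ℝ := arg p₀ - k * (2 * Real.pi) with hϖ₀
    have hpol : p₀ = (‖p₀‖ : ℂ) * cexp ((ϖ₀ : ℂ) * I) := by
      conv_lhs => rw [← norm_mul_exp_arg_mul_I p₀]
      congr 1
      rw [Complex.exp_eq_exp_iff_exists_int]
      exact ⟨k, by rw [hϖ₀]; push_cast; ring⟩
    have hmem := sub_toIocDiv_zsmul_mem_Ioc Real.two_pi_pos (-Real.pi) t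
    rw [← hk, zsmul_eq_mul] at hmem
    have hct := hcos ϖ₀ hpol
    have habs : |t - k * (2 * Real.pi)| < Real.pi / 2 := by
      by_contra! hge
      have h1 := Real.cos_nonpos_of_pi_div_two_le_of_le hge (by
        rw [abs_le]
        exact ⟨by linarith [hmem.1, Real.pi_pos], by linarith [hmem.2, Real.pi_pos]⟩)
      rw [Real.cos_abs] at h1
      have h2 := hct θ₁ ⟨le_rfl, hθ⟩
      rw [show ϖ₀ + θ₁ + μ * ϖ = t - k * (2 * Real.pi) by rw [hϖ₀, ht]; ring] at h2
      linarith
    refine ⟨ϖ₀, hpol, fun θ hθ' => ?_⟩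
    have e : ϖ₀ + θ + μ * ϖ = (t - k * (2 * Real.pi)) + (θ - θ₁) := by rw [hϖ₀, ht]; ring
    have h2 := hct θ hθ'
    rw [abs_lt] at habs
    rw [abs_le]
    refine ⟨by rw [e]; linarith [hθ'.1], ?_⟩
    by_contra! hgt
    have := Real.cos_nonpos_of_pi_div_two_le_of_le hgt.le (by rw [e]; linarith [hθ'.2])
    linarith
  · rintro x y ⟨hx, hx'⟩ ⟨hy, hy'⟩
    have hn : (‖p₀‖ : ℂ) ≠ 0 := by simpa using hp0
    have h1 : cexp ((x : ℂ) * I) = cexp ((y : ℂ) * I) :=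
      mul_left_cancel₀ hn (hx.symm.trans hy)
    obtain ⟨n, hn⟩ := Complex.exp_eq_exp_iff_exists_int.1 h1
    have h2 : x = y + n * (2 * Real.pi) := by
      have := congrArg Complex.im hn
      simpa using this
    have h3 := abs_le.1 (hx' θ₁ ⟨le_rfl, hθ⟩)
    have h4 := abs_le.1 (hy' θ₁ ⟨le_rfl, hθ⟩)
    have hpi := Real.pi_pos
    have h5 : n = 0 := by
      have h6 : (n : ℝ) < 1 := by nlinarith
      have h7 : (-1 : ℝ) < n := by nlinarith
      have h6' : n < 1 := by exact_mod_cast h6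
      have h7' : -1 < n := by exact_mod_cast h7
      omega
    rw [h2, h5]; simp

/-- The constant term of the expansion of `seriesC` is r₀/p₀^(ν/μ). It becomes the argument of
Faxén's integral and is therefore replaced by 0 in the series that enters the Bell polynomials. -/
theorem localSum_eq_partialSum {pc qc rc : ℕ → ℂ} {μ ν ϖ₀ : ℝ} {lam x₀ : ℂ} (hx₀ : x₀ ≠ 0)
    (hp : Summable fun n => pc n * x₀ ^ n) (hq : Summable fun n => qc n * x₀ ^ n)
    (hr : Summable fun n => rc n * x₀ ^ n) (hp0 : pc 0 ≠ 0)
    (hϖ : pc 0 = (‖pc 0‖ : ℂ) * cexp ((ϖ₀ : ℂ) * I)) (hμ : μ ≠ 0) (N : ℕ) (ρ θ : ℝ) :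
    localSum μ (ν / μ) lam (seriesC pc rc μ ν ϖ₀ 0)
      (PowerSeries.mk fun n => quotSeq (localRoot pc ϖ₀ μ) (seriesB pc qc μ lam ϖ₀) n 0)
      (PowerSeries.mk fun k => if k = 0 then 0 else PowerSeries.coeff k
        (PowerSeries.mk fun n => quotSeq (localRoot pc ϖ₀ μ) (seriesC pc rc μ ν ϖ₀) n 0)) N ρ θ
      = partialSum pc qc rc μ ν lam ϖ₀ N ρ θ := by
  have hB : (PowerSeries.mk fun n => quotSeq (localRoot pc ϖ₀ μ) (seriesB pc qc μ lam ϖ₀) n 0)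
      = PowerSeries.mk (coeffB pc qc μ lam ϖ₀) := by
    ext n; simp [coeffB_eq hx₀ hp hq hp0 hμ]
  have hC : (PowerSeries.mk fun k => if k = 0 then 0 else PowerSeries.coeff k
        (PowerSeries.mk fun n => quotSeq (localRoot pc ϖ₀ μ) (seriesC pc rc μ ν ϖ₀) n 0))
      = PowerSeries.mk fun k => if k = 0 then 0 else coeffC pc rc μ ν ϖ₀ k := by
    ext n; simp [coeffC_eq hx₀ hp hr hp0 hϖ hμ]
  rw [hB, hC, localSum, partialSum]
  refine Finset.sum_congr rfl fun n _ => ?_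
  rw [Finset.mul_sum]
  refine Finset.sum_congr rfl fun m _ => ?_
  have hμ' : (μ : ℂ) ≠ 0 := by exact_mod_cast hμ
  have e1 : ((n : ℂ) + lam) / μ + m * ((ν / μ : ℝ) : ℂ) = ((n : ℂ) + lam + (m : ℂ) * ν) / μ := by
    push_cast; field_simp
  have e2 : seriesC pc rc μ ν ϖ₀ 0 = rc 0 / polarPow ‖pc 0‖ ϖ₀ ((ν / μ : ℝ) : ℂ) := by
    rw [seriesC_zero hp0, polarPow_eq, neg_mul, Complex.exp_neg]
    push_cast; rfl
  rw [e1, e2, polarPow_eq_exp, Complex.exp_neg, one_div, mul_assoc]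
  simp only [expCoeff, coeffF, ordBell, PowerSeries.coeff_mk]
  rfl

theorem local_contour_asymptotics {p q r : ℂ → ℂ} {pc qc rc : ℕ → ℂ} {μ ν ϖ₀ δ θ₁ θ₂ : ℝ}
    {lam : ℂ} (hφ : IsArgAlong γ a ϖ φ) (hγ : IsContour γ a b)
    (hν : 0 ≤ ν) (hμν : ν < μ) (hlam : 0 < lam.re) (hp0 : pc 0 ≠ 0)
    (hpe : HasExpansion γ a φ μ pc (fun t => p t - p a))
    (hqe : HasExpansion γ a φ (lam - 1) qc q) (hre : HasExpansion γ a φ ν rc r)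
    (hθ : θ₁ ≤ θ₂) (hδ : 0 < δ) (hδ' : δ ≤ Real.pi / 2)
    (hϖ : pc 0 = (‖pc 0‖ : ℂ) * cexp ((ϖ₀ : ℂ) * I))
    (hlead : ∀ θ ∈ Icc θ₁ θ₂, |ϖ₀ + θ + μ * ϖ| ≤ Real.pi / 2 - δ) (N : ℕ) :
    ∀ᶠ c₀ in 𝓝[>] (0 : ℝ), ∃ C : ℝ, ∀ ρ ≥ 1, ∀ θ ∈ Icc θ₁ θ₂,
      IntegrableOn (integrand p q r γ (ν / μ) ρ θ) (Ioo 0 c₀) ∧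
      ‖(∫ s in Ioo 0 c₀, integrand p q r γ (ν / μ) ρ θ s)
        - cexp (-((ρ : ℂ) * cexp ((θ : ℂ) * I)) * p a) * partialSum pc qc rc μ ν lam ϖ₀ N ρ θ‖
        ≤ C * ‖cexp (-((ρ : ℂ) * cexp ((θ : ℂ) * I)) * p a)‖
            * ρ ^ (-(((N : ℝ) + lam.re) / μ)) := by
  have hμ : 0 < μ := hν.trans_lt hμν
  have hμ' : (μ : ℂ) ≠ 0 := by exact_mod_cast hμ.ne'
  obtain ⟨x₀, hx₀, hp, hq, hr⟩ := hpe.exists_summable hφ hγ hqe hre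
  obtain ⟨m₁, m₂, m₃, hm₁, hm₂, hlow, hup, hΛ'⟩ :=
    exists_norm_exp_phaseLogAlong_bounds hφ hγ hx₀ hp hp0 hϖ hμ
  have hB := analyticAt_seriesB hx₀ hp hq hp0 hμ.ne' lam ϖ₀
  have hC := analyticAt_seriesC hx₀ hp hr hp0 μ ν ϖ₀
  -- Half of the margin δ pays for replacing the limiting phase by the phase at nearby points,
  -- uniformly in θ.
  have him : ∀ᶠ s in 𝓝[>] (0 : ℝ), ∀ θ ∈ Icc θ₁ θ₂,
      |(phaseLogAlong γ a φ pc μ ϖ₀ s).im + θ| ≤ Real.pi / 2 - δ / 2 := by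
    have h1 := tendsto_im_phaseLogAlong hφ hγ hx₀ hp hp0 μ ϖ₀
    filter_upwards [(Metric.tendsto_nhds.1 h1) (δ / 2) (half_pos hδ)] with s hs θ hθ'
    rw [Real.dist_eq] at hs
    have h2 := hlead θ hθ'
    calc _ = |((phaseLogAlong γ a φ pc μ ϖ₀ s).im - (ϖ₀ + μ * ϖ)) + (ϖ₀ + θ + μ * ϖ)| := by
          ring_nf
      _ ≤ _ := (abs_add_le _ _).trans (by linarith)
  have hcomp : ∀ {A : ℂ → ℂ}, AnalyticAt ℂ A 0 →
      ∀ᶠ s in 𝓝[>] (0 : ℝ), ContinuousAt (fun s => A (γ s - a)) s := by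
    intro A hA
    obtain ⟨D, -, h1, -, -, -⟩ := hγ.exists_tangent
    filter_upwards [h1, hγ.tendsto_sub.eventually hA.eventually_analyticAt] with s h2 h3
    exact ContinuousAt.comp (f := fun s => γ s - a) h3.continuousAt
      (h2.continuousAt.sub continuousAt_const)
  have hRt := (hasTrunc_comp hφ hγ hx₀ hp hp0 hμ.ne' ϖ₀ hC).sub_const
  have hQt := hasTrunc_comp hφ hγ hx₀ hp hp0 hμ.ne' ϖ₀ hB
  rw [PowerSeries.coeff_mk] at hRt
  have hmain := local_asymptotics (κ := ν / μ) hμ (by positivity) ((div_lt_one hμ).2 hμν)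
    (by linarith) (by linarith) hlam hθ (seriesC pc rc μ ν ϖ₀ 0) hm₁ hm₂
    (hasDerivAt_phaseLogAlong hφ hγ hx₀ hp hp0 μ ϖ₀)
    (continuousAt_phaseLogAlongDeriv hγ hx₀ hp hp0 μ ϖ₀) hlow hup hΛ' him
    ((hcomp hC).mono fun s hs => hs.sub continuousAt_const) (hcomp hB) hRt hQt
    (tendsto_exp_phaseLogAlong_div hφ hγ hx₀ hp hp0 hμ.ne' ϖ₀)
    (by simp) N
  have hid : ∀ᶠ s in 𝓝[>] (0 : ℝ), ∀ ρ > 0, ∀ θ : ℝ, integrand p q r γ (ν / μ) ρ θ s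
      = cexp (-((ρ : ℂ) * cexp ((θ : ℂ) * I)) * p a) *
        localIntegrand μ (ν / μ) lam (seriesC pc rc μ ν ϖ₀ 0) (phaseLogAlong γ a φ pc μ ϖ₀)
          (phaseLogAlongDeriv γ a pc μ ϖ₀)
          (fun s => seriesC pc rc μ ν ϖ₀ (γ s - a)
            - quotSeq (localRoot pc ϖ₀ μ) (seriesC pc rc μ ν ϖ₀) 0 0)
          (fun s => seriesB pc qc μ lam ϖ₀ (γ s - a)) ρ θ s := by
    filter_upwards [hpe.eventually_eq hφ hγ, hqe.eventually_eq hφ hγ, hre.eventually_eq hφ hγ,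
      exp_phaseLogAlong hγ hx₀ hp hp0 hϖ φ μ, hγ.eventually_ne,
      Ioo_mem_nhdsGT (one_pos (α := ℝ)),
      hγ.tendsto_sub.eventually (eventually_denominator_ne_zero hx₀ hp hp0 hμ.ne' ϖ₀)]
      with s hps hqs hrs hexp hne hs hden ρ hρ θ
    have e1 : p (γ s) = p a + cexp (phaseLogAlong γ a φ pc μ ϖ₀ s) := by
      rw [hexp, ← hps.2]; ring
    have e2 : r (γ s) = cexp ((ν / μ : ℝ) * phaseLogAlong γ a φ pc μ ϖ₀ s)
        * seriesC pc rc μ ν ϖ₀ (γ s - a) := by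
      rw [hrs.2, seriesC, phaseLogAlong, mul_left_comm, ← Complex.exp_add, mul_comm (cexp _)]
      congr 2
      push_cast
      field_simp
      ring
    -- This is q dt = Q y^λ dΛ; the missing factor t - a in (t - a)^(λ-1) is supplied by dΛ.
    have e3 : q (γ s) * deriv γ s = seriesB pc qc μ lam ϖ₀ (γ s - a)
        * cexp (lam / μ * phaseLogAlong γ a φ pc μ ϖ₀ s) * phaseLogAlongDeriv γ a pc μ ϖ₀ s := by
      have e4 : cexp (lam / μ * phaseLogAlong γ a φ pc μ ϖ₀ s)
          = cexp ((lam - 1) * pathLog γ a φ s) * (γ s - a)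
            * cexp (lam / μ * localLog pc ϖ₀ (γ s - a)) := by
        conv_rhs => rw [← hφ.exp_pathLog hs hne]
        rw [← Complex.exp_add, hφ.exp_pathLog hs hne, ← Complex.exp_add, phaseLogAlong]
        congr 1
        field_simp
        ring
      rw [hqs.2, e4, seriesB, phaseLogAlongDeriv, neg_mul, Complex.exp_neg]
      have h5 := Complex.exp_ne_zero (lam / μ * localLog pc ϖ₀ (γ s - a))
      generalize cexp (lam / μ * localLog pc ϖ₀ (γ s - a)) = E at *
      generalize deriv (localLog pc ϖ₀) (γ s - a) = L at *
      field_simp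
    rw [integrand, localIntegrand, mul_assoc _ (q (γ s)), e3, ← mul_assoc (cexp _) (cexp _),
      ← Complex.exp_add, e1, e2, polarPow_eq_exp]
    simp only [quotSeq]
    congr 2
    rw [Complex.exp_add (polarLog ρ θ), exp_polarLog hρ, mul_add ((ν / μ : ℝ) : ℂ),
      Complex.exp_add]
    ring
  rw [eventually_nhdsWithin_iff] at hid
  obtain ⟨c₁, hc₁, hball⟩ := Metric.eventually_nhds_iff_ball.1 hid
  filter_upwards [hmain, Ioo_mem_nhdsGT hc₁] with c₀ ⟨C, hCb⟩ hc₀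
  refine ⟨C, fun ρ hρ θ hθ' => ?_⟩
  obtain ⟨hi, hb⟩ := hCb ρ hρ θ hθ'
  have hρ0 : 0 < ρ := by linarith
  have heq : EqOn (integrand p q r γ (ν / μ) ρ θ) _ (Ioo 0 c₀) := fun s hs =>
    hball s (by
      rw [Metric.mem_ball, dist_zero_right, Real.norm_of_nonneg hs.1.le]
      exact hs.2.trans hc₀.2) hs.1 ρ hρ0 θ
  refine ⟨(integrableOn_congr_fun heq measurableSet_Ioo).2 (hi.const_mul _), ?_⟩
  rw [setIntegral_congr_fun measurableSet_Ioo heq, integral_const_mul, ← mul_sub, norm_mul,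
    ← localSum_eq_partialSum hx₀ hp hq hr hp0 hϖ hμ.ne', mul_comm C, mul_assoc]
  exact mul_le_mul_of_nonneg_left hb (norm_nonneg _)

end

/-! ### The contribution of the rest of the contour -/

section

variable {γ : ℝ → ℂ} {a : ℂ} {b : OnePoint ℂ}

/-- Finitely many arcs cover each [0, σ n], and the corners form a null set, so the ordinary
derivative may be integrated there. -/
theorem IsContour.exists_partition (hγ : IsContour γ a b) : ∃ σ : ℕ → ℝ,
    (∀ s < 1, ∃ n, s < σ n) ∧ (∀ n, ContinuousOn γ (Icc 0 (σ n))) ∧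
      ∀ n, IntegrableOn (deriv γ) (Ioc 0 (σ n)) := by
  obtain ⟨σ, hσ, hσ0, hlim, harc⟩ := hγ.arcs
  have hnn : ∀ n, 0 ≤ σ n := fun n => by rw [← hσ0]; exact hσ.monotone (Nat.zero_le n)
  refine ⟨σ, fun s hs => (hlim.eventually_const_lt hs).exists, fun n => ?_, fun n => ?_⟩
  · induction n with
    | zero => rw [hσ0, Icc_self]; exact continuousOn_singleton _ _
    | succ n ih =>
      rw [← Icc_union_Icc_eq_Icc (hnn n) (hσ n.lt_succ_self).le]
      exact ih.union_of_isClosed (harc n).1.continuousOn isClosed_Icc isClosed_Icc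
  · induction n with
    | zero => simp [hσ0]
    | succ n ih =>
      rw [← Ioc_union_Ioc_eq_Ioc (hnn n) (hσ n.lt_succ_self).le]
      refine ih.union ?_
      have h1 := (continuousOn_derivWithin_of_contDiffOn_Icc (hσ n.lt_succ_self)
        (harc n).1).integrableOn_Icc (μ := volume)
      rw [integrableOn_Ioc_iff_integrableOn_Ioo]
      refine (integrableOn_congr_fun (fun s hs => ?_) measurableSet_Ioo).2
        (h1.mono_set Ioo_subset_Icc_self)
      exact (hasDerivAt_of_contDiffOn_Icc (harc n).1 hs).deriv

theorem IsContour.continuousAt (hγ : IsContour γ a b) {s : ℝ} (hs : s ∈ Ioo (0 : ℝ) 1) :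
    ContinuousAt γ s := by
  obtain ⟨σ, h1, h2, -⟩ := hγ.exists_partition
  obtain ⟨n, hn⟩ := h1 s hs.2
  exact (h2 n).continuousAt (Icc_mem_nhds hs.1 hn)

theorem IsContour.integrableOn_deriv (hγ : IsContour γ a b) {c₀ c₁ : ℝ} (h0 : 0 < c₀)
    (h1 : c₁ < 1) : IntegrableOn (deriv γ) (Icc c₀ c₁) := by
  obtain ⟨σ, h2, -, h3⟩ := hγ.exists_partition
  obtain ⟨n, hn⟩ := h2 c₁ h1
  exact (h3 n).mono_set fun s hs => ⟨h0.trans_le hs.1, hs.2.trans hn.le⟩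

theorem exists_norm_le_on_Ico {f : ℝ → ℂ} {c₀ : ℝ} (hf : ContinuousOn f (Ioo 0 1)) (hc₀ : 0 < c₀)
    (hb : ∃ K : ℝ, ∀ᶠ s in 𝓝[<] (1 : ℝ), ‖f s‖ ≤ K) :
    ∃ K : ℝ, 0 < K ∧ ∀ s ∈ Ico c₀ 1, ‖f s‖ ≤ K := by
  obtain ⟨K₁, hK₁⟩ := hb
  obtain ⟨c₁, hc₁, hsub⟩ := mem_nhdsLT_iff_exists_Ioo_subset.1 hK₁
  have hc₁' : c₁ < 1 := hc₁
  obtain ⟨K₂, hK₂⟩ := (isCompact_Icc (a := c₀) (b := c₁)).exists_bound_of_continuousOn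
    (hf.mono fun s hs => ⟨hc₀.trans_le hs.1, hs.2.trans_lt hc₁'⟩)
  refine ⟨max 1 (max K₁ K₂), lt_of_lt_of_le one_pos (le_max_left _ _), fun s hs => ?_⟩
  rcases le_or_gt s c₁ with h | h
  · exact (hK₂ s ⟨hs.1, h⟩).trans ((le_max_right _ _).trans (le_max_right _ _))
  · exact (hsub ⟨h, hs.2⟩).trans ((le_max_left _ _).trans (le_max_right _ _))

theorem norm_polarPow_ofReal {ρ : ℝ} (hρ : 0 < ρ) (θ κ : ℝ) : ‖polarPow ρ θ κ‖ = ρ ^ κ := by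
  rw [polarPow_eq_exp, norm_exp_real_mul, exp_polarLog hρ, norm_mul, norm_exp_ofReal_mul_I,
    mul_one, norm_real, Real.norm_of_nonneg hρ.le]

/-- Absolute integrability at Z exp(iθ₁) alone controls all large z in the sector: the quotient of
the two exponentials is bounded through |p - p(a)|, which is bounded below on [c₀, 1). -/
theorem exists_tail_bound {p q r : ℂ → ℂ} {T : Set ℂ} {κ θ₁ θ₂ Z δ c₀ : ℝ}
    (hp : AnalyticOnNhd ℂ p T) (hq : AnalyticOnNhd ℂ q T) (hr : AnalyticOnNhd ℂ r T)
    (hγ : IsContour γ a b) (hγT : ∀ s ∈ Ioo (0 : ℝ) 1, γ s ∈ T) (hκ0 : 0 ≤ κ) (hκ1 : κ < 1)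
    (hθ : θ₁ ≤ θ₂) (hZ : 0 < Z) (hsin : 0 < Real.sin δ)
    (habs : ∀ θ ∈ Icc θ₁ θ₂, ∃ c ∈ Ioo (0 : ℝ) 1, IntegrableOn (integrand p q r γ κ Z θ) (Ioo c 1))
    (hne : ∀ s ∈ Ioo (0 : ℝ) 1, p (γ s) ≠ p a)
    (hre : ∀ θ ∈ Icc θ₁ θ₂, ∀ s ∈ Ioo (0 : ℝ) 1, ‖p (γ s) - p a‖ * Real.sin δ
      ≤ (cexp ((θ : ℂ) * I) * p (γ s) - cexp ((θ : ℂ) * I) * p a).re)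
    (haway : ∃ η > 0, ∃ c ∈ Ioo (0 : ℝ) 1, ∀ θ ∈ Icc θ₁ θ₂, ∀ s ∈ Ico c 1,
      η ≤ (cexp ((θ : ℂ) * I) * p (γ s) - cexp ((θ : ℂ) * I) * p a).re)
    (hrO : (fun s => r (γ s)) =O[𝓝[<] (1 : ℝ)] (fun s => p (γ s) - p a))
    (hc₀ : c₀ ∈ Ioo (0 : ℝ) 1) :
    ∃ C R k : ℝ, 0 < k ∧ ∀ ρ ≥ R, ∀ θ ∈ Icc θ₁ θ₂,
      IntegrableOn (integrand p q r γ κ ρ θ) (Ico c₀ 1) ∧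
      ‖∫ s in Ico c₀ 1, integrand p q r γ κ ρ θ s‖
        ≤ C * ‖cexp (-((ρ : ℂ) * cexp ((θ : ℂ) * I)) * p a)‖ * Real.exp (-(k * ρ)) := by
  have hcomp : ∀ {f : ℂ → ℂ}, AnalyticOnNhd ℂ f T → ContinuousOn (fun s => f (γ s)) (Ioo 0 1) :=
    fun hf s hs => (ContinuousAt.comp (hf _ (hγT s hs)).continuousAt
      (hγ.continuousAt hs)).continuousWithinAt
  have hpc := hcomp hp
  have hqc := hcomp hq
  have hrc := hcomp hr
  have hP : ∀ s ∈ Ioo (0 : ℝ) 1, p (γ s) - p a ≠ 0 := fun s hs => sub_ne_zero.2 (hne s hs)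
  obtain ⟨B, hB, hBb⟩ := exists_norm_le_on_Ico (f := fun s => (p (γ s) - p a)⁻¹)
    ((hpc.sub continuousOn_const).inv₀ hP) hc₀.1 (by
      obtain ⟨η, hη, c, hc, h⟩ := haway
      refine ⟨η⁻¹, ?_⟩
      filter_upwards [Ico_mem_nhdsLT hc.2] with s hs
      have h1 := (h θ₁ ⟨le_rfl, hθ⟩ s hs).trans (re_le_norm _)
      rw [← mul_sub, norm_mul, norm_exp_ofReal_mul_I, one_mul] at h1
      rw [norm_inv]
      gcongr)
  obtain ⟨K, hK, hKb⟩ := exists_norm_le_on_Ico (f := fun s => r (γ s) / (p (γ s) - p a))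
    (hrc.div (hpc.sub continuousOn_const) hP) hc₀.1 (by
      obtain ⟨K, hK, h⟩ := hrO.exists_pos
      refine ⟨K, ?_⟩
      filter_upwards [h.bound] with s hs
      rw [norm_div]
      exact div_le_of_le_mul₀ (norm_nonneg _) hK.le hs)
  have hcont : ∀ ρ θ : ℝ, ContinuousOn (fun s => cexp (-((ρ : ℂ) * cexp ((θ : ℂ) * I)) * p (γ s)
      + polarPow ρ θ κ * r (γ s))) (Ioo 0 1) := fun ρ θ =>
    ((continuousOn_const.mul hpc).add (continuousOn_const.mul hrc)).cexp
  have hZint : IntegrableOn (integrand p q r γ κ Z θ₁) (Ico c₀ 1) := by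
    obtain ⟨c, hc, h⟩ := habs θ₁ ⟨le_rfl, hθ⟩
    set c' := (max c c₀ + 1) / 2
    have h1 : max c c₀ < 1 := max_lt hc.2 hc₀.2
    have hc1 : c < c' := by have := le_max_left c c₀; simp only [c']; linarith
    have hc2 : c₀ ≤ c' := by have := le_max_right c c₀; simp only [c']; linarith
    have hc3 : c' < 1 := by simp only [c']; linarith
    have hsub : Icc c₀ c' ⊆ Ioo 0 1 := fun s hs => ⟨hc₀.1.trans_le hs.1, hs.2.trans_lt hc3⟩
    have h2 : IntegrableOn (integrand p q r γ κ Z θ₁) (Icc c₀ c') :=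
      (hγ.integrableOn_deriv hc₀.1 hc3).continuousOn_mul
        (((hcont Z θ₁).mul hqc).mono hsub) isCompact_Icc
    refine (h2.union h).mono_set fun s hs => ?_
    rcases le_or_gt s c' with h3 | h3
    · exact Or.inl ⟨hs.1, h3⟩
    · exact Or.inr ⟨hc1.trans h3, hs.2⟩
  -- Budget for the decay ρ sin δ |p - p(a)|: one half absorbs z^κ r; a quarter absorbs `C₂`, that
  -- is `C₁` and the reference exponent at Z, once ρ ≥ 4 C₂ / sin δ; the last quarter, with |p -
  -- p(a)| ≥ 1/B, gives the rate sin δ / (4B).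
  obtain ⟨C₁, hC₁, hKρ⟩ := exists_mul_rpow_le_mul_add hκ0 hκ1 hK.le (half_pos hsin)
  set C₂ : ℝ := C₁ + Z + Z ^ κ * K with hC₂
  have hC₂0 : 0 ≤ C₂ := by positivity
  set z₁ : ℂ := (Z : ℂ) * cexp ((θ₁ : ℂ) * I) with hz₁
  set J : ℝ := ∫ s in Ico c₀ 1, ‖integrand p q r γ κ Z θ₁ s‖ with hJ
  refine ⟨‖cexp (z₁ * p a)‖ * J, 4 * C₂ / Real.sin δ + 1, Real.sin δ / (4 * B), by positivity,
    fun ρ hρ θ hθ' => ?_⟩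
  have hρ1 : 1 ≤ ρ := by
    have : 0 ≤ 4 * C₂ / Real.sin δ := by positivity
    linarith
  have hρ0 : 0 < ρ := by linarith
  have hρC : C₂ ≤ Real.sin δ / 4 * ρ := by
    have : 4 * C₂ / Real.sin δ ≤ ρ := by linarith
    rw [div_le_iff₀ hsin] at this
    linarith
  set z : ℂ := (ρ : ℂ) * cexp ((θ : ℂ) * I) with hz
  have hid : ∀ s, integrand p q r γ κ ρ θ s = cexp (-z * p (γ s) + polarPow ρ θ κ * r (γ s)
      + z₁ * p (γ s) - polarPow Z θ₁ κ * r (γ s)) * integrand p q r γ κ Z θ₁ s := by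
    intro s
    rw [integrand, integrand, ← hz, ← hz₁, mul_assoc _ (q (γ s)), mul_assoc _ (q (γ s)),
      ← mul_assoc (cexp _) (cexp _), ← Complex.exp_add]
    congr 2
    ring
  have hbound : ∀ s ∈ Ico c₀ 1, ‖integrand p q r γ κ ρ θ s‖
      ≤ ‖cexp (-z * p a)‖ * ‖cexp (z₁ * p a)‖ * Real.exp (-(Real.sin δ / (4 * B) * ρ))
        * ‖integrand p q r γ κ Z θ₁ s‖ := by
    intro s hs
    have hs' : s ∈ Ioo (0 : ℝ) 1 := ⟨hc₀.1.trans_le hs.1, hs.2⟩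
    rw [hid s, norm_mul]
    refine mul_le_mul_of_nonneg_right ?_ (norm_nonneg _)
    rw [← norm_mul, ← Complex.exp_add, norm_exp, norm_exp, ← Real.exp_add, Real.exp_le_exp]
    set P := p (γ s) - p a with hPdef
    have hPn : 0 < ‖P‖ := norm_pos_iff.2 (hP s hs')
    have h1 : ρ * (‖P‖ * Real.sin δ) ≤ (z * P).re := by
      have := hre θ hθ' s hs'
      rw [← mul_sub] at this
      rw [hz, mul_assoc, re_ofReal_mul]
      exact mul_le_mul_of_nonneg_left this hρ0.le
    have hrK : ‖r (γ s)‖ ≤ K * ‖P‖ := by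
      have := hKb s hs
      rwa [norm_div, div_le_iff₀ hPn] at this
    have h2 : (polarPow ρ θ κ * r (γ s)).re ≤ (Real.sin δ / 2 * ρ + C₁) * ‖P‖ := by
      refine (re_le_norm _).trans ?_
      rw [norm_mul, norm_polarPow_ofReal hρ0]
      calc _ ≤ ρ ^ κ * (K * ‖P‖) := by gcongr
        _ = (K * ρ ^ κ) * ‖P‖ := by ring
        _ ≤ _ := by gcongr; exact hKρ ρ hρ0
    have h3 : (z₁ * P).re ≤ Z * ‖P‖ := by
      refine (re_le_norm _).trans ?_
      rw [norm_mul, hz₁, norm_mul, norm_exp_ofReal_mul_I, mul_one, norm_real,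
        Real.norm_of_nonneg hZ.le]
    have h4 : -(polarPow Z θ₁ κ * r (γ s)).re ≤ Z ^ κ * K * ‖P‖ := by
      refine (neg_le_abs _).trans ((abs_re_le_norm _).trans ?_)
      rw [norm_mul, norm_polarPow_ofReal hZ, mul_assoc]
      gcongr
    have h5 : 1 / B ≤ ‖P‖ := by
      have := hBb s hs
      rw [norm_inv] at this
      rw [one_div]
      exact inv_le_of_inv_le₀ hPn this
    have e : -z * p (γ s) + polarPow ρ θ κ * r (γ s) + z₁ * p (γ s) - polarPow Z θ₁ κ * r (γ s)
        = (-z * p a + z₁ * p a) - z * P + polarPow ρ θ κ * r (γ s) + z₁ * P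
          - polarPow Z θ₁ κ * r (γ s) := by rw [hPdef]; ring
    rw [e, sub_re, add_re, add_re, sub_re]
    have h6 : C₂ * ‖P‖ ≤ Real.sin δ / 4 * ρ * ‖P‖ := by gcongr
    have h7 : Real.sin δ / (4 * B) * ρ ≤ Real.sin δ / 4 * ρ * ‖P‖ := by
      calc _ = Real.sin δ / 4 * ρ * (1 / B) := by field_simp
        _ ≤ _ := by gcongr
    rw [hC₂] at h6
    linarith
  have hae : ∀ᵐ s ∂(volume.restrict (Ico c₀ 1)), ‖integrand p q r γ κ ρ θ s‖
      ≤ ‖cexp (-z * p a)‖ * ‖cexp (z₁ * p a)‖ * Real.exp (-(Real.sin δ / (4 * B) * ρ))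
        * ‖integrand p q r γ κ Z θ₁ s‖ :=
    (ae_restrict_iff' measurableSet_Ico).2 (ae_of_all _ hbound)
  have hIcosub : Ico c₀ 1 ⊆ Ioo (0 : ℝ) 1 := fun s hs => ⟨hc₀.1.trans_le hs.1, hs.2⟩
  refine ⟨Integrable.mono' (hZint.norm.const_mul _) ?_ hae, ?_⟩
  · have h1 : ContinuousOn (fun s => cexp (-z * p (γ s) + polarPow ρ θ κ * r (γ s)
      + z₁ * p (γ s) - polarPow Z θ₁ κ * r (γ s))) (Ico c₀ 1) :=
      ((((continuousOn_const.mul hpc).add (continuousOn_const.mul hrc)).add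
        (continuousOn_const.mul hpc)).sub (continuousOn_const.mul hrc)).cexp.mono hIcosub
    rw [show integrand p q r γ κ ρ θ = _ from funext hid]
    exact (h1.aestronglyMeasurable measurableSet_Ico).mul hZint.aestronglyMeasurable
  · refine (norm_integral_le_of_norm_le (hZint.norm.const_mul _) hae).trans (le_of_eq ?_)
    rw [integral_const_mul, ← hJ]
    ring

end

end FaxenExpansion

end

/-! ### Assembly of the theorem -/

open FaxenExpansion in
theorem theorem1
    (p q r : ℂ → ℂ) (T : Set ℂ) (γ : ℝ → ℂ) (a : ℂ) (b : OnePoint ℂ)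
    (ϖ : ℝ) (φ : ℝ → ℝ) (μ ν : ℝ) (lam : ℂ) (pc qc rc : ℕ → ℂ) (θ₁ θ₂ Z δ : ℝ)
    -- (i) analyticity in a domain
    (hTo : IsOpen T) (hTc : IsConnected T)
    (hp : AnalyticOnNhd ℂ p T) (hq : AnalyticOnNhd ℂ q T) (hr : AnalyticOnNhd ℂ r T)
    -- (ii) the path of integration
    (hγ : FaxenExpansion.IsContour γ a b) (hγT : ∀ s ∈ Ioo (0 : ℝ) 1, γ s ∈ T)
    -- (iii) the local expansions at a
    (hφ : FaxenExpansion.IsArgAlong γ a ϖ φ)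
    (hν : 0 ≤ ν) (hμν : ν < μ) (hlam : 0 < lam.re) (hp0 : pc 0 ≠ 0)
    (hpe : FaxenExpansion.HasExpansion γ a φ μ pc (fun t => p t - p a))
    (hqe : FaxenExpansion.HasExpansion γ a φ (lam - 1) qc q)
    (hre : FaxenExpansion.HasExpansion γ a φ ν rc r)
    -- (iv) the sector; absolute and uniform convergence at b for |z| = Z
    (hθ : θ₁ ≤ θ₂) (hθπ : θ₂ - θ₁ < Real.pi) (hZ : 0 < Z)
    (habs : ∀ θ ∈ Icc θ₁ θ₂, ∃ c ∈ Ioo (0 : ℝ) 1,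
      IntegrableOn (FaxenExpansion.integrand p q r γ (ν / μ) Z θ) (Ioo c 1))
    (hunif : ∀ ε > 0, ∃ c ∈ Ioo (0 : ℝ) 1, ∀ c' ∈ Ico c 1, ∀ θ ∈ Icc θ₁ θ₂,
      ‖∫ s in Ioo c' 1, FaxenExpansion.integrand p q r γ (ν / μ) Z θ s‖ ≤ ε)
    -- (v) the phase of p(t) - p(a)
    (hδ : 0 < δ)
    (harg : ∀ θ ∈ Icc θ₁ θ₂, ∀ s ∈ Ioo (0 : ℝ) 1,
      p (γ s) ≠ p a ∧
        |Complex.arg (Complex.exp ((θ : ℂ) * I) * p (γ s) - Complex.exp ((θ : ℂ) * I) * p a)|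
          ≤ Real.pi / 2 - δ)
    (haway : ∃ η > 0, ∃ c ∈ Ioo (0 : ℝ) 1, ∀ θ ∈ Icc θ₁ θ₂, ∀ s ∈ Ico c 1,
      η ≤ (Complex.exp ((θ : ℂ) * I) * p (γ s) - Complex.exp ((θ : ℂ) * I) * p a).re)
    -- (vi) the growth of r at b
    (hrO : (fun s => r (γ s)) =O[𝓝[<] (1 : ℝ)] (fun s => p (γ s) - p a)) :
    (∃! ϖ₀ : ℝ, FaxenExpansion.IsLeadingArg (pc 0) μ ϖ θ₁ θ₂ ϖ₀) ∧
    ∀ ϖ₀ : ℝ, FaxenExpansion.IsLeadingArg (pc 0) μ ϖ θ₁ θ₂ ϖ₀ →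
      (∀ N : ℕ, ∃ C R : ℝ, 0 < R ∧ ∀ ρ ≥ R, ∀ θ ∈ Icc θ₁ θ₂,
        IntegrableOn (FaxenExpansion.integrand p q r γ (ν / μ) ρ θ) (Ioo 0 1) ∧
        ‖FaxenExpansion.contourIntegral p q r γ (ν / μ) ρ θ
            - Complex.exp (-((ρ : ℂ) * Complex.exp ((θ : ℂ) * I)) * p a)
              * FaxenExpansion.partialSum pc qc rc μ ν lam ϖ₀ N ρ θ‖
          ≤ C * ‖Complex.exp (-((ρ : ℂ) * Complex.exp ((θ : ℂ) * I)) * p a)‖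
              * ρ ^ (-(((N : ℝ) + lam.re) / μ))) ∧
      FaxenExpansion.coeffF pc qc rc μ ν lam ϖ₀ 0 0
        = qc 0 / (μ * FaxenExpansion.polarPow ‖pc 0‖ ϖ₀ (lam / μ)) ∧
      FaxenExpansion.coeffF pc qc rc μ ν lam ϖ₀ 1 0
        = (qc 1 / μ - (lam + 1) * pc 1 * qc 0 / ((μ : ℂ) ^ 2 * pc 0))
            * (1 / FaxenExpansion.polarPow ‖pc 0‖ ϖ₀ ((1 + lam) / μ)) ∧
      FaxenExpansion.coeffF pc qc rc μ ν lam ϖ₀ 1 1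
        = (rc 1 / μ - ν * pc 1 * rc 0 / ((μ : ℂ) ^ 2 * pc 0))
            * (qc 0 / FaxenExpansion.polarPow ‖pc 0‖ ϖ₀ ((1 + lam + ν) / μ)) := by
  have hμ : 0 < μ := hν.trans_lt hμν
  obtain ⟨x₀, hx₀, hps, hqs, hrs⟩ := hpe.exists_summable hφ hγ hqe hre
  have hδ' : δ ≤ Real.pi / 2 := by
    have := (abs_nonneg _).trans
      (harg θ₁ ⟨le_rfl, hθ⟩ (1 / 2) ⟨by norm_num, by norm_num⟩).2
    linarith
  have hsin : 0 < Real.sin δ := Real.sin_pos_of_pos_of_lt_pi hδ (by linarith [Real.pi_pos])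
  have hre' : ∀ θ ∈ Icc θ₁ θ₂, ∀ s ∈ Ioo (0 : ℝ) 1, ‖p (γ s) - p a‖ * Real.sin δ
      ≤ (cexp ((θ : ℂ) * I) * p (γ s) - cexp ((θ : ℂ) * I) * p a).re := by
    intro θ hθ' s hs
    have h := norm_mul_sin_le_re hδ (harg θ hθ' s hs).2
    rwa [← mul_sub, norm_mul, norm_exp_ofReal_mul_I, one_mul, mul_sub] at h
  have hcos : ∀ ϖ₀ : ℝ, pc 0 = (‖pc 0‖ : ℂ) * cexp ((ϖ₀ : ℂ) * I) → ∀ θ ∈ Icc θ₁ θ₂,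
      Real.sin δ ≤ Real.cos (ϖ₀ + θ + μ * ϖ) := fun ϖ₀ hϖ θ hθ' =>
    sin_le_cos_leading hφ hγ hx₀ hps hp0 hpe hϖ (hre' θ hθ')
  refine ⟨existsUnique_isLeadingArg hp0 hθ hθπ fun ϖ₀ hϖ θ hθ' =>
    hsin.trans_le (hcos ϖ₀ hϖ θ hθ'), fun ϖ₀ hlead => ⟨fun N => ?_,
    coeffF_zero_zero hx₀ hps hqs hp0 hμ.ne', coeffF_one_zero hx₀ hps hqs hp0 hlead.1 hμ.ne',
    coeffF_one_one hx₀ hps hqs hrs hp0 hlead.1 hμ.ne'⟩⟩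
  -- The bound π/2 that selects ϖ₀ improves by δ, so the limiting phases stay inside an open
  -- half-plane, as the local analysis requires.
  have hlead' : ∀ θ ∈ Icc θ₁ θ₂, |ϖ₀ + θ + μ * ϖ| ≤ Real.pi / 2 - δ := fun θ hθ' =>
    abs_le_of_sin_le_cos hδ' (hlead.2 θ hθ') (hcos ϖ₀ hlead.1 θ hθ')
  obtain ⟨c₀, ⟨C₁, hC₁⟩, hc₀⟩ := ((local_contour_asymptotics hφ hγ hν hμν hlam hp0 hpe hqe hre hθ
    hδ hδ' hlead.1 hlead' N).and (Ioo_mem_nhdsGT (one_pos (α := ℝ)))).exists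
  obtain ⟨C₂, R, k, hk, hC₂⟩ := exists_tail_bound hp hq hr hγ hγT (div_nonneg hν hμ.le)
    ((div_lt_one hμ).2 hμν) hθ hZ hsin habs (fun s hs => (harg θ₁ ⟨le_rfl, hθ⟩ s hs).1) hre'
    haway hrO hc₀
  set e : ℝ := ((N : ℝ) + lam.re) / μ with he
  have he0 : 0 ≤ e := by positivity
  -- The exponentially small tail is downgraded to the power of ρ in the claimed error.
  obtain ⟨C₃, hC₃, hexp⟩ := exists_rpow_mul_exp_neg_le he0 hk
  refine ⟨C₁ + |C₂| * C₃, max 1 R, lt_of_lt_of_le one_pos (le_max_left _ _), fun ρ hρ θ hθ' => ?_⟩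
  have hρ1 : 1 ≤ ρ := (le_max_left _ _).trans hρ
  have hρ0 : 0 < ρ := by linarith
  obtain ⟨i₁, b₁⟩ := hC₁ ρ hρ1 θ hθ'
  obtain ⟨i₂, b₂⟩ := hC₂ ρ ((le_max_right _ _).trans hρ) θ hθ'
  have hunion : Ioo (0 : ℝ) 1 = Ioo 0 c₀ ∪ Ico c₀ 1 := (Ioo_union_Ico_eq_Ioo hc₀.1 hc₀.2.le).symm
  refine ⟨by rw [hunion]; exact i₁.union i₂, ?_⟩
  have hdisj : Disjoint (Ioo 0 c₀) (Ico c₀ 1) :=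
    Set.disjoint_left.2 fun s h1 h2 => absurd h1.2 (not_lt.2 h2.1)
  rw [contourIntegral, hunion, setIntegral_union hdisj measurableSet_Ico i₁ i₂]
  have h3 : Real.exp (-(k * ρ)) ≤ C₃ * ρ ^ (-e) := by
    have := hexp ρ hρ0
    rw [Real.rpow_neg hρ0.le, ← div_eq_mul_inv, le_div_iff₀ (Real.rpow_pos_of_pos hρ0 _)]
    linarith
  set E : ℝ := ‖cexp (-((ρ : ℂ) * cexp ((θ : ℂ) * I)) * p a)‖ with hE
  have h4 : C₂ * E * Real.exp (-(k * ρ)) ≤ |C₂| * E * (C₃ * ρ ^ (-e)) := by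
    have : C₂ ≤ |C₂| := le_abs_self _
    gcongr
  rw [add_sub_right_comm]
  refine (norm_add_le _ _).trans ((add_le_add b₁ (b₂.trans h4)).trans (le_of_eq ?_))
  ring
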